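/- A permutation $\pi$ of $\{1,\dots,n\}$ contains a permutation $\beta$ of $\{1,\dots,m\}$ if some subsequence of $\pi(1)\cdots\pi(n)$ is order isomorphic to $\beta(1)\cdots\beta(m)$; otherwise it avoids $\beta$. For $n\ge 0$ let $a_n$ be the number of $2341$-avoiding involutions of length $n$ (permutations with $\pi=\pi^{-1}$, the identity included); these are exactly the involutions of length $n$ that avoid both $2341$ and $4123$. Let $g=\sum_{n\ge 1}a_nx^n$ be their generating function (the empty permutation is not counted). Then, as formal power series, with $\sqrt{1-4x^2}$ the power series square root having constant term $1$, \[ g=\frac{(x+1)^4(x-1)^{10}\sqrt{1-4x^2}-p(x)}{2q(x)}, \] where $p$ and $q$ are the polynomials of degree $16$ \begin{align*} p(x)=\;&1-8x+17x^2+24x^3-151x^4+162x^5+221x^6-624x^7+231x^8+684x^9-801x^{10}\\ &-60x^{11}+627x^{12}-334x^{13}-101x^{14}+158x^{15}-48x^{16},\\ q(x)=\;&1-6x+4x^2+50x^3-141x^4+55x^5+326x^6-514x^7-26x^8+725x^9-561x^{10}\\ &-223x^{11}+540x^{12}-206x^{13}-113x^{14}+120x^{15}-32x^{16}. \end{align*}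 Moreover, $q$ has exactly one positive real root $\rho$, and the class has a proper growth rate equal to its reciprocal: \[ \limsup_{n\to\infty}\sqrt[n]{a_n}=\liminf_{n\to\infty}\sqrt[n]{a_n}=\frac1\rho\approx 2.54, \] in the sense that $|1/\rho-2.54|<0.005$. -/

import Mathlib

open Filter Topology

namespace PermPattern

/-- `Contains π β`: the permutation `π` contains the pattern `β`, i.e. `π` has a subsequence
(at the positions `f 0 < f 1 < ⋯`) that is order isomorphic to `β`. -/
def Contains {n m : ℕ} (π : Equiv.Perm (Fin n)) (β : Equiv.Perm (Fin m)) : Prop :=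
  ∃ f : Fin m ↪o Fin n, ∀ i j : Fin m, π (f i) < π (f j) ↔ β i < β j

/-- The involutions of length `n` (permutations that are their own inverse, the identity included)
that avoid every pattern in the set `B`. -/
def avI (B : Set (Σ m : ℕ, Equiv.Perm (Fin m))) (n : ℕ) : Set (Equiv.Perm (Fin n)) :=
  {π | Function.Involutive π ∧ ∀ β ∈ B, ¬ Contains π β.2}

/-- The generating function `∑_{n ≥ 1} |Av^I_n(B)| x^n`; the empty permutation is not counted. -/
noncomputable def genFun (B : Set (Σ m : ℕ, Equiv.Perm (Fin m))) : PowerSeries ℝ :=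
  PowerSeries.mk fun n => if n = 0 then 0 else ((avI B n).ncard : ℝ)

/-- The upper growth rate `limsup |Av^I_n(B)|^(1/n)`. -/
noncomputable def upperGrowthRate (B : Set (Σ m : ℕ, Equiv.Perm (Fin m))) : EReal :=
  limsup (fun n : ℕ => ((((avI B n).ncard : ℝ) ^ (1 / (n : ℝ)) : ℝ) : EReal)) atTop

/-- The lower growth rate `liminf |Av^I_n(B)|^(1/n)`. -/
noncomputable def lowerGrowthRate (B : Set (Σ m : ℕ, Equiv.Perm (Fin m))) : EReal :=
  liminf (fun n : ℕ => ((((avI B n).ncard : ℝ) ^ (1 / (n : ℝ)) : ℝ) : EReal)) atTop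

/-- `HasGrowthRate B r`: the upper and lower growth rates of `Av^I(B)` agree and equal `r`. -/
def HasGrowthRate (B : Set (Σ m : ℕ, Equiv.Perm (Fin m))) (r : ℝ) : Prop :=
  upperGrowthRate B = (r : EReal) ∧ lowerGrowthRate B = (r : EReal)

/-- The permutation with one-line notation `2341` (zero-based: `1, 2, 3, 0`). -/
def perm2341 : Equiv.Perm (Fin 4) where
  toFun := ![1, 2, 3, 0]
  invFun := ![3, 0, 1, 2]
  left_inv := by decide
  right_inv := by decide

/-- The permutation with one-line notation `4123` (zero-based: `3, 0, 1, 2`). -/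
def perm4123 : Equiv.Perm (Fin 4) where
  toFun := ![3, 0, 1, 2]
  invFun := ![1, 2, 3, 0]
  left_inv := by decide
  right_inv := by decide

open Polynomial in
noncomputable def polyP : Polynomial ℝ :=
  1 - 8 * X + 17 * X ^ 2 + 24 * X ^ 3 - 151 * X ^ 4 + 162 * X ^ 5 + 221 * X ^ 6 - 624 * X ^ 7
    + 231 * X ^ 8 + 684 * X ^ 9 - 801 * X ^ 10 - 60 * X ^ 11 + 627 * X ^ 12 - 334 * X ^ 13
    - 101 * X ^ 14 + 158 * X ^ 15 - 48 * X ^ 16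

open Polynomial in
noncomputable def polyQ : Polynomial ℝ :=
  1 - 6 * X + 4 * X ^ 2 + 50 * X ^ 3 - 141 * X ^ 4 + 55 * X ^ 5 + 326 * X ^ 6 - 514 * X ^ 7
    - 26 * X ^ 8 + 725 * X ^ 9 - 561 * X ^ 10 - 223 * X ^ 11 + 540 * X ^ 12 - 206 * X ^ 13
    - 113 * X ^ 14 + 120 * X ^ 15 - 32 * X ^ 16

/-- `s` is the formal power series `√(1 - 4x²)`: its square is `1 - 4x²` and its constant term
is `1`. These two conditions determine `s`. -/
def IsSqrtSeries (s : PowerSeries ℝ) : Prop :=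
  s ^ 2 = 1 - 4 * PowerSeries.X ^ 2 ∧ PowerSeries.constantCoeff s = 1

end PermPattern

/-! Since `2341` is sum-indecomposable, a `2341`-avoiding involution is uniquely a sequence of
sum-indecomposable ones. With `A` and `I` the two generating functions, `A = 1 + I * A`
(`setGF_avInvol`), and `g = A - 1`.

The indecomposables are counted according to whether they contain `123`. Involutions avoiding `123`
number `n.choose (n / 2)`, and exactly `n - 1` of them are decomposable, being sums of two
decreasing permutations. The indecomposables containing `123` are exactly the inflations of
`5274163` by decreasing blocks of lengths `a, b, c, d, a, e, c`: the arc at `0` and the arc at `n -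
1` cross, and avoidance of `2341` and of its inverse `4123` fixes everything else
(`exists_eq_inflate`). With `C` the central binomial series, this gives `I = C - 1 - x²/(1-x)² +
x⁷/((1-x)⁵(1+x)²)`. The equation `C(1-2x)(1+xC) = 1` expresses `C` through `√(1-4x²)`, and
rationalising `1/(1-I)` gives the closed form.

With `D = (1-x)⁵(1+x)²` and `M = 2D + x²(1-x)³(1+x)² - x⁷`, one has `I = 1` exactly when `M = DC`,
and `q = (1-2x)M(D+xM) - D²`. So a positive root of `q`, which must lie below `1/2`, satisfies `I(ρ)
= 1`. Nonnegativity of the coefficients of `I` makes it unique. The renewal recurrence from `A = 1 +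
I * A` then gives `a_n ρ^n ≤ 1`, and `a_n r^n` bounded below for every `ρ < r ≤ 1`, hence the growth
rate. -/

namespace PermPattern

/-! ### Involutions as functions on the natural numbers -/

/-- An involution of `{0, …, n - 1}`, extended by the identity to all natural numbers. -/
def IsInvol (f : ℕ → ℕ) (n : ℕ) : Prop :=
  (∀ i, f (f i) = i) ∧ ∀ i, n ≤ i → f i = i

/-- No subsequence of `f` is order isomorphic to `2341`. -/
def Avoids2341 (f : ℕ → ℕ) : Prop :=
  ∀ a b c d, a < b → b < c → c < d → f d < f a → f a < f b → f b < f c → False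

/-- No subsequence of `f` on the positions below `n` is increasing of length three. -/
def Avoids123 (f : ℕ → ℕ) (n : ℕ) : Prop :=
  ∀ a b c, a < b → b < c → c < n → f a < f b → f b < f c → False

/-- The `2341`-avoiding involutions of length `n`. -/
def avInvol (n : ℕ) : Set (ℕ → ℕ) := {f | IsInvol f n ∧ Avoids2341 f}

theorem IsInvol.invol {f : ℕ → ℕ} {n : ℕ} (h : IsInvol f n) (i : ℕ) : f (f i) = i := h.1 i

theorem IsInvol.eq_self {f : ℕ → ℕ} {n i : ℕ} (h : IsInvol f n) (hi : n ≤ i) : f i = i := h.2 i hi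

theorem IsInvol.inj {f : ℕ → ℕ} {n : ℕ} (h : IsInvol f n) {i j : ℕ} (e : f i = f j) : i = j := by
  rw [← h.1 i, e, h.1]

theorem IsInvol.lt {f : ℕ → ℕ} {n i : ℕ} (h : IsInvol f n) (hi : i < n) : f i < n := by
  by_contra hc
  have h1 := h.2 (f i) (by omega)
  rw [h.1] at h1
  omega

theorem finite_isInvol (n : ℕ) : {f | IsInvol f n}.Finite := by
  let F : {f | IsInvol f n} → (Fin n → Fin n) := fun f i => ⟨f.1 i, f.2.lt i.2⟩
  have hF : Function.Injective F := by
    intro f g hfg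
    apply Subtype.ext
    funext i
    by_cases hi : i < n
    · have := congrFun hfg ⟨i, hi⟩
      simpa [F] using this
    · rw [f.2.eq_self (by omega), g.2.eq_self (by omega)]
  exact Set.finite_coe_iff.mp (Finite.of_injective F hF)

theorem finite_avInvol (n : ℕ) : (avInvol n).Finite :=
  (finite_isInvol n).subset fun _ h => h.1

/-! ### Pattern containment, and passage from `Fin n` to the natural numbers -/

theorem contains_perm2341_iff {n : ℕ} (π : Equiv.Perm (Fin n)) :
    Contains π perm2341 ↔
      ∃ a b c d, a < b ∧ b < c ∧ c < d ∧ π d < π a ∧ π a < π b ∧ π b < π c := by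
  constructor
  · rintro ⟨f, hf⟩
    refine ⟨f 0, f 1, f 2, f 3, f.strictMono (by decide), f.strictMono (by decide),
      f.strictMono (by decide), (hf _ _).2 (by decide), (hf _ _).2 (by decide),
      (hf _ _).2 (by decide)⟩
  · rintro ⟨a, b, c, d, h1, h2, h3, h4, h5, h6⟩
    refine ⟨OrderEmbedding.ofStrictMono ![a, b, c, d] ?_, ?_⟩
    · rw [Fin.strictMono_iff_lt_succ]
      intro i
      fin_cases i
      exacts [h1, h2, h3]
    · have e : ∀ i, (perm2341 i : Fin 4) = ![1, 2, 3, 0] i := fun _ => rfl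
      intro i j
      rw [e, e]
      fin_cases i <;> fin_cases j <;> simp [OrderEmbedding.ofStrictMono] <;> omega

theorem exists_of_contains_perm4123 {n : ℕ} (π : Equiv.Perm (Fin n)) :
    Contains π perm4123 →
      ∃ a b c d, a < b ∧ b < c ∧ c < d ∧ π b < π c ∧ π c < π d ∧ π d < π a := by
  rintro ⟨f, hf⟩
  exact ⟨f 0, f 1, f 2, f 3, f.strictMono (by decide), f.strictMono (by decide),
    f.strictMono (by decide), (hf _ _).2 (by decide), (hf _ _).2 (by decide),
    (hf _ _).2 (by decide)⟩

/-- The two patterns are inverse to each other, and an involution equals its own inverse: positions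
and values of the occurrence trade places. -/
theorem contains_perm2341_of_contains_perm4123 {n : ℕ} {π : Equiv.Perm (Fin n)}
    (hπ : Function.Involutive π) (h : Contains π perm4123) : Contains π perm2341 := by
  obtain ⟨a, b, c, d, h1, h2, h3, h4, h5, h6⟩ := exists_of_contains_perm4123 π h
  rw [contains_perm2341_iff]
  exact ⟨π b, π c, π d, π a, h4, h5, h6, by simpa only [hπ _], by simpa only [hπ _],
    by simpa only [hπ _]⟩

theorem avI_perm2341_eq (n : ℕ) :
    avI {⟨4, perm2341⟩} n = avI {⟨4, perm2341⟩, ⟨4, perm4123⟩} n := by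
  ext π
  simp only [avI, Set.mem_ofPred_eq, Set.mem_singleton_iff, forall_eq, Set.mem_insert_iff,
    forall_eq_or_imp]
  exact ⟨fun h => ⟨h.1, h.2, fun h' => h.2 (contains_perm2341_of_contains_perm4123 h.1 h')⟩,
    fun h => ⟨h.1, h.2.1⟩⟩

/-- The extension of a permutation of `Fin n` by the identity. -/
def extendNat {n : ℕ} (π : Equiv.Perm (Fin n)) (i : ℕ) : ℕ := if h : i < n then π ⟨i, h⟩ else i

theorem extendNat_of_lt {n : ℕ} (π : Equiv.Perm (Fin n)) {i : ℕ} (h : i < n) :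
    extendNat π i = π ⟨i, h⟩ := dif_pos h

theorem extendNat_of_le {n : ℕ} (π : Equiv.Perm (Fin n)) {i : ℕ} (h : n ≤ i) :
    extendNat π i = i := dif_neg (by omega)

theorem extendNat_injective {n : ℕ} :
    Function.Injective (extendNat : Equiv.Perm (Fin n) → ℕ → ℕ) := by
  intro π σ h
  ext i
  have := congrFun h i
  rwa [extendNat_of_lt π i.2, extendNat_of_lt σ i.2] at this

theorem isInvol_extendNat {n : ℕ} {π : Equiv.Perm (Fin n)} (h : Function.Involutive π) :
    IsInvol (extendNat π) n := by
  refine ⟨fun i => ?_, fun i hi => extendNat_of_le π hi⟩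
  by_cases hi : i < n
  · rw [extendNat_of_lt π hi, extendNat_of_lt π (Fin.is_lt _)]
    simp [h _]
  · rw [extendNat_of_le π (i := i) (by omega), extendNat_of_le π (by omega)]

theorem avoids2341_extendNat_iff {n : ℕ} (π : Equiv.Perm (Fin n)) :
    Avoids2341 (extendNat π) ↔ ¬ Contains π perm2341 := by
  have hlt : ∀ i, i < n → extendNat π i < n := fun i hi => by
    rw [extendNat_of_lt π hi]; exact Fin.is_lt _
  rw [contains_perm2341_iff]
  constructor
  · rintro h ⟨a, b, c, d, h1, h2, h3, h4, h5, h6⟩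
    refine h a b c d h1 h2 h3 ?_ ?_ ?_ <;>
    · rw [extendNat_of_lt π (Fin.is_lt _), extendNat_of_lt π (Fin.is_lt _)]
      assumption
  · intro h a b c d h1 h2 h3 h4 h5 h6
    have hd : d < n := by
      by_contra hd
      rw [extendNat_of_le π (i := d) (by omega)] at h4
      by_cases ha : a < n
      · have := hlt a ha; omega
      · rw [extendNat_of_le π (i := a) (by omega)] at h4; omega
    rw [extendNat_of_lt π (by omega : a < n), extendNat_of_lt π (by omega : d < n)] at h4
    rw [extendNat_of_lt π (by omega : a < n), extendNat_of_lt π (by omega : b < n)] at h5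
    rw [extendNat_of_lt π (by omega : b < n), extendNat_of_lt π (by omega : c < n)] at h6
    exact h ⟨⟨a, by omega⟩, ⟨b, by omega⟩, ⟨c, by omega⟩, ⟨d, by omega⟩, h1, h2, h3, h4, h5, h6⟩

theorem image_extendNat_avI (n : ℕ) : extendNat '' avI {⟨4, perm2341⟩} n = avInvol n := by
  ext f
  simp only [avI, Set.mem_singleton_iff, forall_eq, Set.mem_image, Set.mem_ofPred_eq, avInvol]
  constructor
  · rintro ⟨π, ⟨h1, h2⟩, rfl⟩
    exact ⟨isInvol_extendNat h1, (avoids2341_extendNat_iff π).2 h2⟩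
  · rintro ⟨h1, h2⟩
    let F : Fin n → Fin n := fun i => ⟨f i, h1.lt i.2⟩
    have hF : Function.Involutive F := fun i => Fin.ext (h1.invol i)
    have he : extendNat hF.toPerm = f := by
      funext i
      by_cases hi : i < n
      · rw [extendNat_of_lt _ hi]; rfl
      · rw [extendNat_of_le _ (by omega), h1.eq_self (by omega)]
    refine ⟨hF.toPerm, ⟨hF, ?_⟩, he⟩
    rw [← avoids2341_extendNat_iff, he]
    exact h2

theorem ncard_avI (n : ℕ) : (avI {⟨4, perm2341⟩} n).ncard = (avInvol n).ncard := by
  rw [← image_extendNat_avI, Set.ncard_image_of_injective _ extendNat_injective]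

/-! ### Generating functions of weighted types -/

/-- The generating function of a type `U` with respect to the weight `w`. -/
noncomputable def weightGF {U : Type*} (w : U → ℕ) : PowerSeries ℝ :=
  PowerSeries.mk fun n => (Nat.card {u // w u = n} : ℝ)

theorem weightGF_prod {U V : Type*} (w : U → ℕ) (w' : V → ℕ) (hw : ∀ n, Finite {u // w u = n})
    (hw' : ∀ n, Finite {v // w' v = n}) :
    weightGF (fun p : U × V => w p.1 + w' p.2) = weightGF w * weightGF w' := by
  ext n
  rw [PowerSeries.coeff_mul]
  simp only [weightGF, PowerSeries.coeff_mk]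
  let e : {p : U × V // w p.1 + w' p.2 = n} ≃
      Σ ij : Finset.HasAntidiagonal.antidiagonal n, {u // w u = ij.1.1} × {v // w' v = ij.1.2} :=
    { toFun := fun p => ⟨⟨(w p.1.1, w' p.1.2), by simpa using p.2⟩, ⟨p.1.1, rfl⟩, ⟨p.1.2, rfl⟩⟩
      invFun := fun q => ⟨(q.2.1.1, q.2.2.1), by
        have := q.1.2
        rw [Finset.HasAntidiagonal.mem_antidiagonal] at this
        have h1 := q.2.1.2
        have h2 := q.2.2.2
        dsimp only
        omega⟩
      left_inv := fun p => rfl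
      right_inv := by
        rintro ⟨⟨⟨i, j⟩, h⟩, ⟨u, hu⟩, ⟨v, hv⟩⟩
        dsimp only at hu hv
        subst hu hv
        rfl }
  rw [Nat.card_congr e, Nat.card_sigma, Nat.cast_sum,
    ← Finset.sum_coe_sort (Finset.HasAntidiagonal.antidiagonal n)]
  simp [Nat.card_prod]

theorem finite_weight_prod {U V : Type*} (w : U → ℕ) (w' : V → ℕ)
    (hw : ∀ n, Finite {u // w u = n}) (hw' : ∀ n, Finite {v // w' v = n}) (n : ℕ) :
    Finite {p : U × V // w p.1 + w' p.2 = n} := by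
  let F : {p : U × V // w p.1 + w' p.2 = n} →
      Σ ij : Finset.HasAntidiagonal.antidiagonal n, {u // w u = ij.1.1} × {v // w' v = ij.1.2} :=
    fun p => ⟨⟨(w p.1.1, w' p.1.2), by simpa using p.2⟩, ⟨p.1.1, rfl⟩, ⟨p.1.2, rfl⟩⟩
  refine Finite.of_injective F ?_
  rintro ⟨⟨u, v⟩, h⟩ ⟨⟨u', v'⟩, h'⟩ e
  let G : (Σ ij : Finset.HasAntidiagonal.antidiagonal n, {u // w u = ij.1.1} × {v // w' v = ij.1.2}) → U × V :=
    fun q => (q.2.1.1, q.2.2.1)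
  exact Subtype.ext (congrArg G e)

/-! ### Direct sums -/

/-- No proper initial segment is preserved: `f` is not a direct sum. -/
def Indec (f : ℕ → ℕ) (n : ℕ) : Prop := ∀ j, 0 < j → j < n → ∃ i < j, j ≤ f i

/-- The sum-indecomposable `2341`-avoiding involutions of length `n`. -/
def indecInvol (n : ℕ) : Set (ℕ → ℕ) := {f | 0 < n ∧ f ∈ avInvol n ∧ Indec f n}

theorem finite_indecInvol (n : ℕ) : (indecInvol n).Finite :=
  (finite_avInvol n).subset fun _ h => h.2.1

/-- The direct sum of an involution `h` of length `k` and an involution `g`. -/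
def directSum (k : ℕ) (h g : ℕ → ℕ) (i : ℕ) : ℕ := if i < k then h i else k + g (i - k)

theorem directSum_of_lt {k : ℕ} {h g : ℕ → ℕ} {i : ℕ} (hi : i < k) :
    directSum k h g i = h i := if_pos hi

theorem directSum_of_le {k : ℕ} {h g : ℕ → ℕ} {i : ℕ} (hi : k ≤ i) :
    directSum k h g i = k + g (i - k) := if_neg (by omega)

theorem isInvol_directSum {k m : ℕ} {h g : ℕ → ℕ} (hh : IsInvol h k) (hg : IsInvol g m) :
    IsInvol (directSum k h g) (k + m) := by
  constructor
  · intro i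
    by_cases hi : i < k
    · rw [directSum_of_lt hi, directSum_of_lt (hh.lt hi), hh.invol]
    · rw [directSum_of_le (i := i) (by omega), directSum_of_le (by omega), Nat.add_sub_cancel_left,
        hg.invol]
      omega
  · intro i hi
    rw [directSum_of_le (by omega), hg.eq_self (by omega)]
    omega

/-- An occurrence cannot straddle the summands: its last entry is its smallest, so if its first
position lies in the first summand, so does its last. -/
theorem avoids2341_directSum {k : ℕ} {h g : ℕ → ℕ} (hk : IsInvol h k) (hh : Avoids2341 h)
    (hg : Avoids2341 g) : Avoids2341 (directSum k h g) := by
  intro a b c d h1 h2 h3 h4 h5 h6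
  by_cases ha : a < k
  · have hd : d < k := by
      by_contra hd
      rw [directSum_of_lt ha, directSum_of_le (i := d) (by omega)] at h4
      have := hk.lt ha
      omega
    rw [directSum_of_lt (by omega), directSum_of_lt (by omega)] at h4 h5 h6
    exact hh a b c d h1 h2 h3 h4 h5 h6
  · rw [directSum_of_le (by omega), directSum_of_le (by omega)] at h4 h5 h6
    exact hg (a - k) (b - k) (c - k) (d - k) (by omega) (by omega) (by omega) (by omega)
      (by omega) (by omega)

/-- The length of the first summand is determined as the shortest nonempty preserved prefix; a
longer indecomposable summand would have an entry crossing that cut. -/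
theorem directSum_inj {k m k' m' : ℕ} {h g h' g' : ℕ → ℕ} (hh : h ∈ indecInvol k)
    (hh' : h' ∈ indecInvol k') (hkm : k + m = k' + m')
    (e : directSum k h g = directSum k' h' g') : k = k' ∧ h = h' ∧ g = g' := by
  have key : ∀ {k k' : ℕ} {h g h' g' : ℕ → ℕ}, h ∈ indecInvol k → h' ∈ indecInvol k' →
      directSum k h g = directSum k' h' g' → ¬ k < k' := by
    intro k k' h g h' g' hh hh' e hlt
    obtain ⟨i, hi, hi'⟩ := hh'.2.2 k hh.1 hlt
    have e1 := congrFun e i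
    rw [directSum_of_lt hi, directSum_of_lt (by omega)] at e1
    have := hh.2.1.1.lt hi
    omega
  have hk : k = k' := by
    have h1 := key hh hh' e
    have h2 := key hh' hh e.symm
    omega
  subst hk
  refine ⟨rfl, ?_, ?_⟩
  · funext i
    by_cases hi : i < k
    · have e1 := congrFun e i
      rwa [directSum_of_lt hi, directSum_of_lt hi] at e1
    · rw [hh.2.1.1.eq_self (by omega), hh'.2.1.1.eq_self (by omega)]
  · funext i
    have e1 := congrFun e (k + i)
    rw [directSum_of_le (by omega), directSum_of_le (by omega)] at e1
    simpa using e1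

theorem exists_directSum {n : ℕ} (hn : 0 < n) {f : ℕ → ℕ} (hf : f ∈ avInvol n) :
    ∃ k m h g, k + m = n ∧ h ∈ indecInvol k ∧ g ∈ avInvol m ∧ directSum k h g = f := by
  classical
  -- Minimality of the preserved prefix makes the first summand indecomposable.
  have hex : ∃ k, 0 < k ∧ ∀ i < k, f i < k := ⟨n, hn, fun i hi => hf.1.lt hi⟩
  obtain ⟨hk0, hk⟩ := Nat.find_spec hex
  have hmin : ∀ j, j < Nat.find hex → ¬ (0 < j ∧ ∀ i < j, f i < j) := fun j hj =>
    Nat.find_min hex hj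
  have hkn : Nat.find hex ≤ n := Nat.find_min' hex ⟨hn, fun i hi => hf.1.lt hi⟩
  generalize Nat.find hex = k at hk0 hk hmin hkn
  have hk' : ∀ i, k ≤ i → k ≤ f i := by
    intro i hi
    by_contra hc
    have := hk (f i) (by omega)
    rw [hf.1.invol] at this
    omega
  refine ⟨k, n - k, fun i => if i < k then f i else i, fun i => f (k + i) - k, by omega,
    ⟨hk0, ⟨⟨fun i => ?_, fun i hi => if_neg (by omega)⟩, ?_⟩, ?_⟩, ⟨⟨fun i => ?_, fun i hi => ?_⟩, ?_⟩, ?_⟩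
  · dsimp only
    by_cases hi : i < k
    · rw [if_pos hi, if_pos (hk i hi), hf.1.invol]
    · rw [if_neg hi, if_neg hi]
  · intro a b c d h1 h2 h3 h4 h5 h6
    dsimp only at h4 h5 h6
    by_cases hd : d < k
    · rw [if_pos (by omega), if_pos (by omega)] at h4 h5 h6
      exact hf.2 a b c d h1 h2 h3 h4 h5 h6
    · rw [if_neg hd] at h4
      by_cases ha : a < k
      · rw [if_pos ha] at h4
        have := hk a ha
        omega
      · rw [if_neg ha] at h4
        omega
  · intro j hj hjk
    have := hmin j hjk
    push Not at this
    obtain ⟨i, hi, hi'⟩ := this hj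
    exact ⟨i, hi, by dsimp only; rwa [if_pos (by omega)]⟩
  · dsimp only
    have := hk' (k + i) (by omega)
    rw [show k + (f (k + i) - k) = f (k + i) by omega, hf.1.invol]
    omega
  · dsimp only
    rw [hf.1.eq_self (by omega)]
    omega
  · intro a b c d h1 h2 h3 h4 h5 h6
    dsimp only at h4 h5 h6
    have ha := hk' (k + a) (by omega)
    have hb := hk' (k + b) (by omega)
    have hc := hk' (k + c) (by omega)
    have hd := hk' (k + d) (by omega)
    exact hf.2 (k + a) (k + b) (k + c) (k + d) (by omega) (by omega) (by omega) (by omega)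
      (by omega) (by omega)
  · funext i
    by_cases hi : i < k
    · rw [directSum_of_lt hi, if_pos hi]
    · rw [directSum_of_le (by omega)]
      have := hk' i (by omega)
      rw [show k + (i - k) = i by omega]
      omega

/-- The generating function of the sets `S n`. -/
noncomputable def setGF (S : ℕ → Set (ℕ → ℕ)) : PowerSeries ℝ :=
  PowerSeries.mk fun n => ((S n).ncard : ℝ)

/-- The functions in `S n` among the disjoint union of all `S n`. -/
def fiberEquiv (S : ℕ → Set (ℕ → ℕ)) (n : ℕ) :
    {u : {x : ℕ × (ℕ → ℕ) // x.2 ∈ S x.1} // u.1.1 = n} ≃ S n where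
  toFun u := ⟨u.1.1.2, by
    obtain ⟨⟨⟨k, f⟩, h⟩, rfl⟩ := u
    exact h⟩
  invFun f := ⟨⟨(n, f.1), f.2⟩, rfl⟩
  left_inv := by
    rintro ⟨⟨⟨k, f⟩, h⟩, rfl⟩
    rfl
  right_inv _ := rfl

theorem setGF_eq_weightGF (S : ℕ → Set (ℕ → ℕ)) :
    setGF S = weightGF fun u : {x : ℕ × (ℕ → ℕ) // x.2 ∈ S x.1} => u.1.1 := by
  ext n
  simp only [setGF, weightGF, PowerSeries.coeff_mk]
  rw [Nat.card_congr (fiberEquiv S n), Nat.card_coe_set_eq]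

theorem ncard_avInvol_zero : (avInvol 0).ncard = 1 := by
  rw [Set.ncard_eq_one]
  refine ⟨id, Set.eq_singleton_iff_unique_mem.2 ⟨⟨⟨fun _ => rfl, fun _ _ => rfl⟩, ?_⟩, ?_⟩⟩
  · intro a b c d h1 h2 h3 h4
    simp only [id] at h4
    omega
  · intro f hf
    funext i
    exact hf.1.eq_self (Nat.zero_le _)

theorem setGF_avInvol : setGF avInvol = 1 + setGF indecInvol * setGF avInvol := by
  have fin1 : ∀ n, Finite {u : {x : ℕ × (ℕ → ℕ) // x.2 ∈ indecInvol x.1} // u.1.1 = n} :=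
    fun n => have := (finite_indecInvol n).to_subtype
      Finite.of_equiv _ (fiberEquiv indecInvol n).symm
  have fin2 : ∀ n, Finite {u : {x : ℕ × (ℕ → ℕ) // x.2 ∈ avInvol x.1} // u.1.1 = n} :=
    fun n => have := (finite_avInvol n).to_subtype
      Finite.of_equiv _ (fiberEquiv avInvol n).symm
  rw [setGF_eq_weightGF indecInvol]
  nth_rw 2 [setGF_eq_weightGF avInvol]
  rw [← weightGF_prod _ _ fin1 fin2]
  ext n
  simp only [map_add, PowerSeries.coeff_one, setGF, weightGF, PowerSeries.coeff_mk]
  rcases Nat.eq_zero_or_pos n with rfl | hn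
  · rw [ncard_avInvol_zero, if_pos rfl]
    have : IsEmpty {u : {x : ℕ × (ℕ → ℕ) // x.2 ∈ indecInvol x.1} ×
        {x : ℕ × (ℕ → ℕ) // x.2 ∈ avInvol x.1} // u.1.1.1 + u.2.1.1 = 0} :=
      ⟨fun u => by have := u.1.1.2.1; have := u.2; omega⟩
    rw [Nat.card_of_isEmpty]
    simp
  · rw [if_neg (by omega), zero_add, ← Nat.card_coe_set_eq]
    congr 1
    symm
    refine Nat.card_eq_of_bijective (fun p => ⟨directSum p.1.1.1.1 p.1.1.1.2 p.1.2.1.2, ?_, ?_⟩)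
      ⟨?_, ?_⟩
    · have := isInvol_directSum p.1.1.2.2.1.1 p.1.2.2.1
      rwa [p.2] at this
    · exact avoids2341_directSum p.1.1.2.2.1.1 p.1.1.2.2.1.2 p.1.2.2.2
    · rintro ⟨⟨⟨⟨k, h⟩, hh⟩, ⟨⟨m, g⟩, hg⟩⟩, e⟩ ⟨⟨⟨⟨k', h'⟩, hh'⟩, ⟨⟨m', g'⟩, hg'⟩⟩, e'⟩ heq
      dsimp only at e e'
      obtain ⟨rfl, rfl, rfl⟩ := directSum_inj (m := m) (m' := m') hh hh' (by omega)
        (congrArg Subtype.val heq)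
      obtain rfl : m = m' := by omega
      rfl
    · rintro ⟨f, hf⟩
      obtain ⟨k, m, h, g, e, hh, hg, rfl⟩ := exists_directSum hn hf
      exact ⟨⟨⟨⟨(k, h), hh⟩, ⟨(m, g), hg⟩⟩, e⟩, rfl⟩

/-! ### Involutions avoiding `123` -/

/-- A strictly decreasing map between intervals of equal length is the reversal. -/
theorem add_eq_of_decreasing {f : ℕ → ℕ} {p q l : ℕ}
    (hdec : ∀ i j, p ≤ i → i < j → j < p + l → f j < f i)
    (hmem : ∀ i, p ≤ i → i < p + l → q ≤ f i ∧ f i < q + l) {i : ℕ} (h1 : p ≤ i)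
    (h2 : i < p + l) : f i + i + 1 = p + q + l := by
  -- Descending from the left end bounds each value above, climbing back from the right end bounds
  -- it below, and the two bounds agree.
  have up : ∀ k, k < l → f (p + k) + k < q + l := by
    intro k
    induction k with
    | zero => intro hk; exact (hmem p le_rfl (by omega)).2
    | succ k ih =>
      intro hk
      have := ih (by omega)
      have := hdec (p + k) (p + (k + 1)) (by omega) (by omega) (by omega)
      omega
  have down : ∀ k, k < l → q + k ≤ f (p + (l - 1 - k)) := by
    intro k
    induction k with
    | zero => intro hk; exact (hmem _ (by omega) (by omega)).1
    | succ k ih =>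
      intro hk
      have := ih (by omega)
      have := hdec (p + (l - 1 - (k + 1))) (p + (l - 1 - k)) (by omega) (by omega) (by omega)
      omega
  have h3 := up (i - p) (by omega)
  have h4 := down (l - 1 - (i - p)) (by omega)
  rw [show p + (i - p) = i by omega] at h3
  rw [show p + (l - 1 - (l - 1 - (i - p))) = i by omega] at h4
  omega

/-- The `123`-avoiding involutions of length `n` that are decreasing on the first `t` positions. -/
def decPrefix (n t : ℕ) : Set (ℕ → ℕ) :=
  {f | IsInvol f n ∧ Avoids123 f n ∧ ∀ i j, i < j → j < t → f j < f i}

theorem finite_decPrefix (n t : ℕ) : (decPrefix n t).Finite :=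
  (finite_isInvol n).subset fun _ h => h.1

/-- The order-preserving injection that omits the value `p`. -/
def bump (p i : ℕ) : ℕ := if i < p then i else i + 1

theorem bump_lt_bump {p i j : ℕ} : bump p i < bump p j ↔ i < j := by
  unfold bump; split_ifs <;> omega

theorem bump_inj {p i j : ℕ} : bump p i = bump p j ↔ i = j := by
  unfold bump; split_ifs <;> omega

theorem bump_ne (p i : ℕ) : bump p i ≠ p := by
  unfold bump; split_ifs <;> omega

theorem bump_of_lt {p i : ℕ} (h : i < p) : bump p i = i := if_pos h

theorem bump_le (p i : ℕ) : bump p i ≤ i + 1 := by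
  unfold bump; split_ifs <;> omega

theorem exists_bump {p x : ℕ} (h : x ≠ p) : ∃ i, bump p i = x ∧ i ≤ x ∧ (p < x → i < x) := by
  rcases Nat.lt_or_gt_of_ne h with h | h
  · exact ⟨x, if_pos h, le_rfl, fun _ => by omega⟩
  · exact ⟨x - 1, by unfold bump; rw [if_neg (by omega)]; omega, by omega, fun _ => by omega⟩

/-- Insert into an involution `g` of length `n` a transposition of the new last position with the
position `p`. -/
def insertLast (n p : ℕ) (g : ℕ → ℕ) (x : ℕ) : ℕ :=
  if x = n + 1 then p else if x = p then n + 1 else if n + 1 < x then x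
  else bump p (g (if x < p then x else x - 1))

theorem insertLast_last (n p : ℕ) (g : ℕ → ℕ) : insertLast n p g (n + 1) = p := if_pos rfl

theorem insertLast_self {n p : ℕ} (hp : p ≤ n) (g : ℕ → ℕ) : insertLast n p g p = n + 1 := by
  unfold insertLast
  rw [if_neg (by omega), if_pos rfl]

theorem insertLast_bump {n p i : ℕ} (hp : p ≤ n) (g : ℕ → ℕ) (hi : i < n) :
    insertLast n p g (bump p i) = bump p (g i) := by
  have h1 := bump_ne p i
  have h2 := bump_le p i
  unfold insertLast
  rw [if_neg (by omega), if_neg h1, if_neg (by omega)]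
  congr 2
  unfold bump
  split_ifs <;> omega

theorem insertLast_of_lt {n p i : ℕ} (hp : p ≤ n) (g : ℕ → ℕ) (hi : i < p) :
    insertLast n p g i = bump p (g i) := by
  have := insertLast_bump (i := i) hp g (by omega)
  rwa [bump_of_lt hi] at this

theorem insertLast_of_le {n p x : ℕ} (hp : p ≤ n) (g : ℕ → ℕ) (hx : n + 2 ≤ x) :
    insertLast n p g x = x := by
  unfold insertLast
  rw [if_neg (by omega), if_neg (by omega), if_pos (by omega)]

theorem position_cases {n p x : ℕ} (hp : p ≤ n) (hx : x < n + 2) :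
    x = n + 1 ∨ x = p ∨ ∃ i < n, x = bump p i := by
  by_cases h1 : x = n + 1
  · exact Or.inl h1
  by_cases h2 : x = p
  · exact Or.inr (Or.inl h2)
  obtain ⟨i, hi, hi1, hi2⟩ := exists_bump h2
  refine Or.inr (Or.inr ⟨i, ?_, hi.symm⟩)
  by_cases h3 : p < x
  · have := hi2 h3; omega
  · omega

theorem isInvol_insertLast {n p : ℕ} (hp : p ≤ n) {g : ℕ → ℕ} (hg : IsInvol g n) :
    IsInvol (insertLast n p g) (n + 2) := by
  refine ⟨fun x => ?_, fun x hx => insertLast_of_le hp g hx⟩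
  by_cases hx : x < n + 2
  · rcases position_cases hp hx with rfl | rfl | ⟨i, hi, rfl⟩
    · rw [insertLast_last, insertLast_self hp]
    · rw [insertLast_self hp, insertLast_last]
    · rw [insertLast_bump hp g hi, insertLast_bump hp g (hg.lt hi), hg.invol]
  · rw [insertLast_of_le (x := x) hp g (by omega), insertLast_of_le hp g (by omega)]

theorem exists_eq_insertLast {n p : ℕ} (hp : p ≤ n) {f : ℕ → ℕ} (hf : IsInvol f (n + 2))
    (hfp : f (n + 1) = p) : ∃ g, IsInvol g n ∧ f = insertLast n p g := by
  have hfp' : f p = n + 1 := by rw [← hfp, hf.invol]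
  have key : ∀ i < n, ∃ j < n, f (bump p i) = bump p j := by
    intro i hi
    have h1 := bump_ne p i
    have h2 := bump_le p i
    rcases position_cases hp (hf.lt (show bump p i < n + 2 by omega)) with h | h | h
    · exact absurd (hf.inj (h.trans hfp'.symm)) h1
    · have := hf.inj (h.trans hfp.symm)
      omega
    · exact h
  choose! g hg using key
  let g' : ℕ → ℕ := fun i => if i < n then g i else i
  have hg' : ∀ i < n, g' i = g i := fun i hi => if_pos hi
  refine ⟨g', ⟨fun i => ?_, fun i hi => if_neg (by omega)⟩, ?_⟩
  · by_cases hi : i < n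
    · rw [hg' i hi, hg' _ (hg i hi).1]
      have h1 := (hg _ (hg i hi).1).2
      rw [← (hg i hi).2, hf.invol, bump_inj] at h1
      exact h1.symm
    · have : g' i = i := if_neg hi
      rw [this, this]
  · funext x
    by_cases hx : x < n + 2
    · rcases position_cases hp hx with rfl | rfl | ⟨i, hi, rfl⟩
      · rw [hfp, insertLast_last]
      · rw [hfp', insertLast_self hp]
      · rw [insertLast_bump hp g' hi, hg' i hi, (hg i hi).2]
    · rw [insertLast_of_le hp g' (by omega), hf.eq_self (by omega)]

theorem insertLast_inj {n p : ℕ} (hp : p ≤ n) {g g' : ℕ → ℕ} (hg : IsInvol g n)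
    (hg' : IsInvol g' n) (e : insertLast n p g = insertLast n p g') : g = g' := by
  funext i
  by_cases hi : i < n
  · have := congrFun e (bump p i)
    rwa [insertLast_bump hp g hi, insertLast_bump hp g' hi, bump_inj] at this
  · rw [hg.eq_self (by omega), hg'.eq_self (by omega)]

theorem avoids123_of_insertLast {n p : ℕ} (hp : p ≤ n) {g : ℕ → ℕ}
    (h : Avoids123 (insertLast n p g) (n + 2)) : Avoids123 g n := by
  intro a b c h1 h2 h3 h4 h5
  have := bump_le p c
  refine h (bump p a) (bump p b) (bump p c) (bump_lt_bump.2 h1) (bump_lt_bump.2 h2) (by omega) ?_ ?_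
  · rw [insertLast_bump hp g (by omega), insertLast_bump hp g (by omega)]
    exact bump_lt_bump.2 h4
  · rw [insertLast_bump hp g (by omega), insertLast_bump hp g (by omega)]
    exact bump_lt_bump.2 h5

/-- A new entry can only be the last of a `123`. The maximum at `p` would need an ascent before `p`;
the value `p` at the end would, after inversion, need an ascent at positions below `p`. -/
theorem avoids123_insertLast {n p : ℕ} (hp : p ≤ n) {g : ℕ → ℕ} (hg : IsInvol g n)
    (hav : Avoids123 g n) (hdec : ∀ i j, i < j → j < p → g j < g i) :
    Avoids123 (insertLast n p g) (n + 2) := by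
  have hI := isInvol_insertLast hp hg
  have dec : ∀ i j, i < j → j < p → insertLast n p g j < insertLast n p g i := by
    intro i j hij hj
    rw [insertLast_of_lt hp g hj, insertLast_of_lt hp g (by omega)]
    exact bump_lt_bump.2 (hdec i j hij hj)
  have lt : ∀ x < n + 2, insertLast n p g x < n + 2 := fun x hx => hI.lt hx
  intro a b c h1 h2 h3 h4 h5
  have l1 := lt c h3
  rcases position_cases hp h3 with rfl | rfl | ⟨k, hk, rfl⟩
  · rw [insertLast_last] at h5
    have := dec _ _ h4 h5
    rw [hI.invol, hI.invol] at this
    omega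
  · have := dec a b h1 h2
    omega
  · rcases position_cases hp (show b < n + 2 by omega) with rfl | rfl | ⟨j, hj, rfl⟩
    · have := bump_le p k
      omega
    · rw [insertLast_self hp] at h5
      omega
    · rcases position_cases hp (show a < n + 2 by omega) with rfl | rfl | ⟨i, hi, rfl⟩
      · have := bump_le p j
        omega
      · rw [insertLast_self hp] at h4
        omega
      · rw [insertLast_bump hp g hi, insertLast_bump hp g hj, bump_lt_bump] at h4
        rw [insertLast_bump hp g hk, insertLast_bump hp g hj, bump_lt_bump] at h5
        exact hav i j k (bump_lt_bump.1 h1) (bump_lt_bump.1 h2) hk h4 h5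

theorem decPrefix_succ_subset (n m : ℕ) : decPrefix n (m + 1) ⊆ decPrefix n m :=
  fun _ h => ⟨h.1, h.2.1, fun i j hij hj => h.2.2 i j hij (by omega)⟩

theorem exists_lt_of_not_mem_decPrefix {n m : ℕ} {f : ℕ → ℕ} (hf : f ∈ decPrefix n m)
    (hf' : f ∉ decPrefix n (m + 1)) : ∃ i < m, f i < f m := by
  by_contra hc
  push Not at hc
  refine hf' ⟨hf.1, hf.2.1, fun i j hij hj => ?_⟩
  rcases Nat.lt_or_ge j m with h | h
  · exact hf.2.2 i j hij h
  · obtain rfl : j = m := by omega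
    have h1 := hc i hij
    have h2 : f j ≠ f i := fun e => by have := hf.1.inj e; omega
    omega

/-- If the maximum stood after `m`, it would extend the ascent from `i` to `m` to a `123`; strictly
between `0` and `m`, it would break the decreasing prefix. -/
theorem position_max {n m : ℕ} {f : ℕ → ℕ} (hf : f ∈ decPrefix (n + 2) m) (hm : m ≤ n + 1)
    {i : ℕ} (hi : i < m) (him : f i < f m) :
    f (n + 1) = 0 ∨ f (n + 1) = m := by
  have h1 : f (f (n + 1)) = n + 1 := hf.1.invol _
  have h2 : f (n + 1) < n + 2 := hf.1.lt (by omega)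
  generalize f (n + 1) = p at h1 h2 ⊢
  have h3 : ∀ x < n + 2, x ≠ p → f x < n + 1 := by
    intro x hx hxp
    have := hf.1.lt hx
    have : f x ≠ n + 1 := fun e => hxp (hf.1.inj (e.trans h1.symm))
    omega
  by_contra hc
  push Not at hc
  rcases Nat.lt_or_ge m p with h | h
  · have := h3 m (by omega) (by omega)
    exact hf.2.1 i m p hi h h2 him (by omega)
  · have := hf.2.2 0 p (by omega) (by omega)
    have := h3 0 (by omega) (by omega)
    omega

/-- Either the prefix stays decreasing one step further, or the maximum is at `m + 1` or at `0`;
then its transposition is removed. In the last case positions shift by one, so the first ascent of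
what remains is at position `m`. -/
theorem decPrefix_eq_union {n m : ℕ} (hm : m + 1 ≤ n) :
    decPrefix (n + 2) (m + 1) = decPrefix (n + 2) (m + 2) ∪
      (insertLast n (m + 1) '' decPrefix n (m + 1) ∪
        insertLast n 0 '' (decPrefix n m \ decPrefix n (m + 1))) := by
  ext f
  constructor
  · intro hf
    by_cases hf' : f ∈ decPrefix (n + 2) (m + 2)
    · exact Or.inl hf'
    refine Or.inr ?_
    obtain ⟨i, hi, him⟩ := exists_lt_of_not_mem_decPrefix hf hf'
    rcases position_max hf (by omega) hi him with hp | hp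
    · obtain ⟨g, hg, rfl⟩ := exists_eq_insertLast (Nat.zero_le n) hf.1 hp
      have hs : ∀ j < n, insertLast n 0 g (j + 1) = g j + 1 := fun j hj =>
        insertLast_bump (Nat.zero_le n) g hj
      refine Or.inr ⟨g, ⟨⟨hg, avoids123_of_insertLast (Nat.zero_le n) hf.2.1, ?_⟩, ?_⟩, rfl⟩
      · intro j k hjk hk
        have := hf.2.2 (j + 1) (k + 1) (by omega) (by omega)
        rw [hs j (by omega), hs k (by omega)] at this
        omega
      · intro hg'
        have hi0 : i ≠ 0 := by
          rintro rfl
          rw [insertLast_self (Nat.zero_le n)] at him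
          have := hf.1.lt (show m + 1 < n + 2 by omega)
          omega
        have := hg'.2.2 (i - 1) m (by omega) (by omega)
        rw [hs m (by omega), show i = (i - 1) + 1 by omega, hs (i - 1) (by omega)] at him
        omega
    · obtain ⟨g, hg, rfl⟩ := exists_eq_insertLast hm hf.1 hp
      refine Or.inl ⟨g, ⟨hg, avoids123_of_insertLast hm hf.2.1, ?_⟩, rfl⟩
      intro j k hjk hk
      have := hf.2.2 j k hjk hk
      rwa [insertLast_of_lt hm g hk, insertLast_of_lt hm g (by omega), bump_lt_bump] at this
  · rintro (hf | ⟨g, hg, rfl⟩ | ⟨g, ⟨hg, hg'⟩, rfl⟩)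
    · exact decPrefix_succ_subset _ _ hf
    · refine ⟨isInvol_insertLast hm hg.1, avoids123_insertLast hm hg.1 hg.2.1 hg.2.2, ?_⟩
      intro j k hjk hk
      rw [insertLast_of_lt hm g hk, insertLast_of_lt hm g (by omega), bump_lt_bump]
      exact hg.2.2 j k hjk hk
    · have hI := isInvol_insertLast (Nat.zero_le n) hg.1
      refine ⟨hI, avoids123_insertLast (Nat.zero_le n) hg.1 hg.2.1 (fun _ _ _ h => by omega), ?_⟩
      intro j k hjk hk
      have hs : ∀ j < n, insertLast n 0 g (j + 1) = g j + 1 := fun j hj =>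
        insertLast_bump (Nat.zero_le n) g hj
      rcases Nat.eq_zero_or_pos j with rfl | hj
      · rw [insertLast_self (Nat.zero_le n), show k = (k - 1) + 1 by omega, hs _ (by omega)]
        have := hg.1.lt (show k - 1 < n by omega)
        omega
      · rw [show k = (k - 1) + 1 by omega, hs _ (by omega), show j = (j - 1) + 1 by omega,
          hs _ (by omega)]
        have := hg.2.2 (j - 1) (k - 1) (by omega) (by omega)
        omega

/-- The two families of insertions come from complementary subsets of `decPrefix n m`, so together
they contribute its full size. -/
theorem ncard_decPrefix_succ {n m : ℕ} (hm : m + 1 ≤ n) :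
    (decPrefix (n + 2) (m + 1)).ncard =
      (decPrefix (n + 2) (m + 2)).ncard + (decPrefix n m).ncard := by
  have f1 := finite_decPrefix (n + 2) (m + 2)
  have f2 : (insertLast n (m + 1) '' decPrefix n (m + 1)).Finite := (finite_decPrefix _ _).image _
  have f3 : (insertLast n 0 '' (decPrefix n m \ decPrefix n (m + 1))).Finite :=
    (finite_decPrefix _ _).sdiff.image _
  have d23 : Disjoint (insertLast n (m + 1) '' decPrefix n (m + 1))
      (insertLast n 0 '' (decPrefix n m \ decPrefix n (m + 1))) := by
    rw [Set.disjoint_left]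
    rintro _ ⟨g, hg, rfl⟩ ⟨g', hg', e⟩
    have := congrFun e (n + 1)
    rw [insertLast_last, insertLast_last] at this
    omega
  have d1 : Disjoint (decPrefix (n + 2) (m + 2)) (insertLast n (m + 1) '' decPrefix n (m + 1) ∪
      insertLast n 0 '' (decPrefix n m \ decPrefix n (m + 1))) := by
    rw [Set.disjoint_left]
    rintro f hf (⟨g, hg, rfl⟩ | ⟨g, ⟨hg, hg'⟩, rfl⟩)
    · have h1 := hf.2.2 m (m + 1) (by omega) (by omega)
      rw [insertLast_self hm] at h1
      have := hf.1.lt (show m < n + 2 by omega)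
      omega
    · obtain ⟨i, hi, him⟩ := exists_lt_of_not_mem_decPrefix hg hg'
      have h1 := hf.2.2 (i + 1) (m + 1) (by omega) (by omega)
      have hs : ∀ j < n, insertLast n 0 g (j + 1) = g j + 1 := fun j hj =>
        insertLast_bump (Nat.zero_le n) g hj
      rw [hs _ (by omega), hs _ (by omega)] at h1
      omega
  rw [decPrefix_eq_union hm, Set.ncard_union_eq d1 f1 (f2.union f3), Set.ncard_union_eq d23 f2 f3,
    Set.InjOn.ncard_image fun g hg g' hg' e => insertLast_inj hm hg.1 hg'.1 e,
    Set.InjOn.ncard_image fun g hg g' hg' e =>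
      insertLast_inj (Nat.zero_le n) hg.1.1 hg'.1.1 e,
    add_comm (decPrefix n (m + 1)).ncard,
    Set.ncard_sdiff_add_ncard_of_subset (decPrefix_succ_subset n m) (finite_decPrefix _ _)]

/-- The decreasing permutation of length `n`. -/
def revPerm (n i : ℕ) : ℕ := if i < n then n - 1 - i else i

theorem revPerm_of_lt {n i : ℕ} (h : i < n) : revPerm n i = n - 1 - i := if_pos h

theorem isInvol_revPerm {n m : ℕ} (h : n ≤ m) : IsInvol (revPerm n) m := by
  constructor
  · intro i
    unfold revPerm
    split_ifs <;> omega
  · intro i hi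
    exact if_neg (by omega)

theorem eq_revPerm {n m : ℕ} {f : ℕ → ℕ} (hf : IsInvol f m) (hm : ∀ i, n ≤ i → f i = i)
    (hdec : ∀ i j, i < j → j < n → f j < f i) : f = revPerm n := by
  have hI : IsInvol f n := ⟨hf.1, hm⟩
  funext i
  unfold revPerm
  split_ifs with hi
  · have := add_eq_of_decreasing (f := f) (p := 0) (q := 0) (l := n)
      (fun i j _ hij hj => hdec i j hij (by omega))
      (fun i _ hi => ⟨Nat.zero_le _, by have := hI.lt (show i < n by omega); omega⟩)
      (Nat.zero_le i) (by omega)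
    omega
  · exact hm i (by omega)

theorem revPerm_mem_decPrefix (n : ℕ) : revPerm n ∈ decPrefix n n := by
  have hdec : ∀ i j, i < j → j < n → revPerm n j < revPerm n i := by
    intro i j hij hj
    rw [revPerm_of_lt hj, revPerm_of_lt (by omega)]
    omega
  refine ⟨isInvol_revPerm le_rfl, ?_, hdec⟩
  intro a b c h1 h2 h3 h4 h5
  have := hdec a b h1 (by omega)
  omega

theorem ncard_decPrefix_self (n : ℕ) : (decPrefix n n).ncard = 1 := by
  rw [Set.ncard_eq_one]
  exact ⟨revPerm n, Set.eq_singleton_iff_unique_mem.2 ⟨revPerm_mem_decPrefix n,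
    fun f hf => eq_revPerm hf.1 hf.1.2 hf.2.2⟩⟩

theorem ncard_decPrefix_pred (n : ℕ) : (decPrefix (n + 2) (n + 1)).ncard = 2 := by
  have h : decPrefix (n + 2) (n + 1) = insert (revPerm (n + 1)) (decPrefix (n + 2) (n + 2)) := by
    ext f
    constructor
    · intro hf
      by_cases hf' : f ∈ decPrefix (n + 2) (n + 2)
      · exact Or.inr hf'
      obtain ⟨i, hi, him⟩ := exists_lt_of_not_mem_decPrefix hf hf'
      rcases position_max hf le_rfl hi him with hp | hp
      · omega
      · refine Or.inl (eq_revPerm hf.1 (fun j hj => ?_) hf.2.2)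
        rcases Nat.eq_or_lt_of_le hj with rfl | hj
        · exact hp
        · exact hf.1.2 j hj
    · rintro (rfl | hf)
      · have hdec : ∀ i j, i < j → j < n + 1 → revPerm (n + 1) j < revPerm (n + 1) i := by
          intro i j hij hj
          rw [revPerm_of_lt hj, revPerm_of_lt (by omega)]
          omega
        refine ⟨isInvol_revPerm (by omega), ?_, hdec⟩
        intro a b c h1 h2 h3 h4 h5
        have := hdec a b h1 (by omega)
        omega
      · exact decPrefix_succ_subset _ _ hf
  rw [h, Set.ncard_insert_of_notMem _ (finite_decPrefix _ _), ncard_decPrefix_self]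
  intro hf
  have := hf.2.2 n (n + 1) (by omega) (by omega)
  simp only [revPerm] at this
  split_ifs at this <;> omega

theorem decPrefix_zero (n : ℕ) : decPrefix n 0 = decPrefix n 1 := by
  ext f
  exact ⟨fun h => ⟨h.1, h.2.1, fun i j _ _ => by omega⟩,
    fun h => ⟨h.1, h.2.1, fun i j _ _ => by omega⟩⟩

/-- The sum of the first `r` binomial coefficients in row `k`. -/
def binomSum (k r : ℕ) : ℕ := ∑ j ∈ Finset.range r, k.choose j

theorem binomSum_zero (k : ℕ) : binomSum k 0 = 0 := rfl

theorem binomSum_succ (k r : ℕ) : binomSum k (r + 1) = binomSum k r + k.choose r :=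
  Finset.sum_range_succ _ _

theorem binomSum_pascal (k r : ℕ) :
    binomSum (k + 1) (r + 1) = binomSum k (r + 1) + binomSum k r := by
  induction r with
  | zero => simp [binomSum]
  | succ r ih =>
    rw [binomSum_succ (k + 1), ih, binomSum_succ k (r + 1), binomSum_succ k r,
      Nat.choose_succ_succ']
    omega

theorem binomSum_zero_left (r : ℕ) : binomSum 0 (r + 1) = 1 := by
  induction r with
  | zero => rfl
  | succ r ih => rw [binomSum_succ, ih]; simp

/-- The sets for `0` and `1` coincide, so the two formulas must agree; Pascal's rule shows that they
do. -/
theorem ncard_decPrefix_zero_of_one {n : ℕ} (h : 1 ≤ n)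
    (hn : (decPrefix n 1).ncard + binomSum (n - 1) (n / 2 - 1) = binomSum (n - 1) (n / 2 + 1)) :
    (decPrefix n 0).ncard + binomSum n (n / 2) = binomSum n (n / 2 + 1) := by
  rw [decPrefix_zero]
  obtain ⟨k, rfl⟩ : ∃ k, n = k + 1 := ⟨n - 1, by omega⟩
  rw [Nat.add_sub_cancel] at hn
  generalize (k + 1) / 2 = r at hn ⊢
  rw [binomSum_pascal k r]
  cases r with
  | zero => simp only [binomSum_zero, Nat.zero_sub] at hn ⊢; omega
  | succ r =>
    rw [binomSum_pascal k r]
    rw [Nat.add_sub_cancel] at hn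
    omega

/-- The count is the sum of `(n - m).choose j` over `n / 2 - m ≤ j ≤ n / 2`, where truncated
subtraction cuts the range at `0`. By Pascal's rule this solves the recurrence
`ncard_decPrefix_succ`. -/
theorem ncard_decPrefix (n : ℕ) : ∀ m ≤ n,
    (decPrefix n m).ncard + binomSum (n - m) (n / 2 - m) = binomSum (n - m) (n / 2 + 1) := by
  induction n using Nat.twoStepInduction with
  | zero =>
    intro m hm
    obtain rfl : m = 0 := by omega
    rw [ncard_decPrefix_self]
    rfl
  | one =>
    have h1 : (decPrefix 1 1).ncard + binomSum (1 - 1) (1 / 2 - 1) = binomSum (1 - 1) (1 / 2 + 1) := by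
      rw [ncard_decPrefix_self]
      rfl
    intro m hm
    rcases Nat.eq_zero_or_pos m with rfl | hm'
    · exact ncard_decPrefix_zero_of_one le_rfl h1
    · obtain rfl : m = 1 := by omega
      exact h1
  | more n ih _ =>
    -- Inner induction on `k = n + 2 - m`. The cases `k = 0` and `k = 1` lie outside the recurrence
    -- and are counted directly.
    have hpos : ∀ k, k ≤ n + 1 → (decPrefix (n + 2) (n + 2 - k)).ncard +
        binomSum k ((n + 2) / 2 - (n + 2 - k)) = binomSum k ((n + 2) / 2 + 1) := by
      intro k
      induction k with
      | zero =>
        intro _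
        rw [Nat.sub_zero, ncard_decPrefix_self, binomSum_zero_left,
          show (n + 2) / 2 - (n + 2) = 0 by omega]
        rfl
      | succ k ihk =>
        intro hk
        rcases Nat.eq_zero_or_pos k with rfl | hk0
        · rw [show n + 2 - (0 + 1) = n + 1 by omega, ncard_decPrefix_pred, binomSum_pascal,
            show (n + 2) / 2 - (n + 1) = 0 by omega, show (n + 2) / 2 = n / 2 + 1 by omega,
            binomSum_zero_left, binomSum_zero_left]
          rfl
        · have h1 := ihk (by omega)
          obtain ⟨m, hm⟩ : ∃ m, n + 1 = k + 1 + m := ⟨n + 1 - (k + 1), by omega⟩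
          have h2 := ih m (by omega)
          rw [show n + 2 - (k + 1) = m + 1 by omega, ncard_decPrefix_succ (by omega)]
          rw [show n + 2 - k = m + 2 by omega] at h1
          rw [show n - m = k by omega] at h2
          rw [show (n + 2) / 2 = n / 2 + 1 by omega] at h1 ⊢
          rw [binomSum_pascal k (n / 2 + 1)]
          rw [show n / 2 + 1 - (m + 1) = n / 2 - m by omega]
          rw [show n / 2 + 1 - (m + 2) = n / 2 - m - 1 by omega] at h1
          generalize n / 2 - m = r at h1 h2 ⊢
          cases r with
          | zero => simp only [binomSum_zero, Nat.zero_sub] at h1 h2 ⊢; omega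
          | succ r =>
            rw [binomSum_pascal k r]
            rw [Nat.add_sub_cancel] at h1
            omega
    intro m hm
    rcases Nat.eq_zero_or_pos m with rfl | hm'
    · refine ncard_decPrefix_zero_of_one (by omega) ?_
      have := hpos (n + 1) le_rfl
      rwa [show n + 2 - (n + 1) = 1 by omega] at this
    · have := hpos (n + 2 - m) (by omega)
      rwa [show n + 2 - (n + 2 - m) = m by omega] at this

/-- The `123`-avoiding involutions of length `n` are counted by the central binomial
coefficients. -/
theorem ncard_decPrefix_zero (n : ℕ) : (decPrefix n 0).ncard = n.choose (n / 2) := by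
  have := ncard_decPrefix n 0 (Nat.zero_le n)
  rw [Nat.sub_zero, Nat.sub_zero, binomSum_succ] at this
  omega

/-! ### Sum-decomposable involutions avoiding `123` -/

theorem avoids2341_of_avoids123 {n : ℕ} {f : ℕ → ℕ} (hf : IsInvol f n) (h : Avoids123 f n) :
    Avoids2341 f := by
  intro a b c d h1 h2 h3 h4 h5 h6
  have hd : d < n := by
    by_contra hd
    rw [hf.eq_self (i := d) (by omega)] at h4
    by_cases ha : a < n
    · have := hf.lt ha; omega
    · rw [hf.eq_self (by omega)] at h4; omega
  exact h a b c h1 h2 (by omega) h5 h6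

/-- The direct sum of two decreasing permutations of lengths `k` and `n - k`. -/
def revSum (n k i : ℕ) : ℕ := if i < k then k - 1 - i else if i < n then n + k - 1 - i else i

theorem revSum_mem {n k : ℕ} (hk : 0 < k) (hkn : k < n) :
    revSum n k ∈ decPrefix n 0 ∧ ¬ Indec (revSum n k) n := by
  refine ⟨⟨⟨fun i => ?_, fun i hi => ?_⟩, ?_, fun _ _ _ _ => by omega⟩, ?_⟩
  · unfold revSum; split_ifs <;> omega
  · unfold revSum; split_ifs <;> omega
  · intro a b c h1 h2 h3 h4 h5
    unfold revSum at h4 h5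
    split_ifs at h4 h5 <;> omega
  · intro h
    obtain ⟨i, hi, hi'⟩ := h k hk hkn
    unfold revSum at hi'
    split_ifs at hi'
    omega

/-- An ascent in either summand, together with any entry of the other, is a `123`; hence both
summands are decreasing. -/
theorem exists_eq_revSum {n : ℕ} {f : ℕ → ℕ} (hf : IsInvol f n) (hav : Avoids123 f n)
    (hdec : ¬ Indec f n) : ∃ k, 0 < k ∧ k < n ∧ revSum n k = f := by
  unfold Indec at hdec
  push Not at hdec
  obtain ⟨k, hk0, hkn, hk⟩ := hdec
  have hk' : ∀ i, k ≤ i → k ≤ f i := by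
    intro i hi
    by_contra hc
    have := hk (f i) (by omega)
    rw [hf.invol] at this
    omega
  have ne : ∀ {i j}, i < j → f i ≠ f j := fun hij e => by have := hf.inj e; omega
  refine ⟨k, hk0, hkn, ?_⟩
  funext i
  unfold revSum
  split_ifs with h1 h2
  · have := add_eq_of_decreasing (f := f) (p := 0) (q := 0) (l := k) (fun i j _ hij hj => by
      by_contra hc
      have := ne hij
      have := hk j (by omega)
      have := hk' (n - 1) (by omega)
      exact hav i j (n - 1) hij (by omega) (by omega) (by omega) (by omega))
      (fun i _ hi => ⟨Nat.zero_le _, by have := hk i (by omega); omega⟩) (Nat.zero_le i) (by omega)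
    omega
  · have := add_eq_of_decreasing (f := f) (p := k) (q := k) (l := n - k) (fun i j hi hij hj => by
      by_contra hc
      have := ne hij
      have := hk' i hi
      have := hk 0 hk0
      exact hav 0 i j (by omega) hij (by omega) (by omega) (by omega))
      (fun i hi hi' => ⟨hk' i hi, by have := hf.lt (show i < n by omega); omega⟩)
      (show k ≤ i by omega) (by omega)
    omega
  · exact (hf.eq_self (by omega)).symm

theorem ncard_indec_avoids123 {n : ℕ} (hn : 0 < n) :
    ({f ∈ indecInvol n | Avoids123 f n}).ncard + (n - 1) = n.choose (n / 2) := by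
  have h : decPrefix n 0 = {f ∈ indecInvol n | Avoids123 f n} ∪ revSum n '' (Set.Ioo 0 n) := by
    ext f
    constructor
    · intro hf
      by_cases hi : Indec f n
      · exact Or.inl ⟨⟨hn, ⟨hf.1, avoids2341_of_avoids123 hf.1 hf.2.1⟩, hi⟩, hf.2.1⟩
      · obtain ⟨k, h1, h2, h3⟩ := exists_eq_revSum hf.1 hf.2.1 hi
        exact Or.inr ⟨k, ⟨h1, h2⟩, h3⟩
    · rintro (hf | ⟨k, ⟨h1, h2⟩, rfl⟩)
      · exact ⟨hf.1.2.1.1, hf.2, fun _ _ _ _ => by omega⟩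
      · exact (revSum_mem h1 h2).1
  have hd : Disjoint {f ∈ indecInvol n | Avoids123 f n} (revSum n '' (Set.Ioo 0 n)) := by
    rw [Set.disjoint_left]
    rintro _ hf ⟨k, ⟨h1, h2⟩, rfl⟩
    exact (revSum_mem h1 h2).2 hf.1.2.2
  rw [← ncard_decPrefix_zero, h, Set.ncard_union_eq hd ((finite_indecInvol n).subset
    fun _ h => h.1) ((Set.finite_Ioo 0 n).image _), Set.InjOn.ncard_image]
  · rw [Set.ncard_eq_toFinset_card' (Set.Ioo 0 n), Set.toFinset_Ioo, Nat.card_Ioo]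
    omega
  · rintro k ⟨hk, hk'⟩ l ⟨hl, hl'⟩ e
    have := congrFun e 0
    simp only [revSum] at this
    split_ifs at this <;> omega

/-! ### Sum-indecomposable involutions containing `123` -/

/-- The inflation of the involution `5274163` by decreasing permutations of lengths
`a, b, c, d, a, e, c`. -/
def inflate (a b c d e i : ℕ) : ℕ :=
  if i < a then 2 * a + b + c + d - 1 - i
  else if i < a + b then 2 * a + b - 1 - i
  else if i < a + b + c then 3 * a + 2 * b + 2 * c + d + e - 1 - i
  else if i < a + b + c + d then 2 * (a + b + c) + d - 1 - i
  else if i < 2 * a + b + c + d then 2 * a + b + c + d - 1 - i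
  else if i < 2 * a + b + c + d + e then 2 * (2 * a + b + c + d) + e - 1 - i
  else if i < 2 * a + b + 2 * c + d + e then 3 * a + 2 * b + 2 * c + d + e - 1 - i
  else i

section inflate

variable {a b c d e n : ℕ}

/-- On each block `i + f i` is constant, so statements about inflations become linear arithmetic. -/
theorem inflate_cases (a b c d e : ℕ) {i : ℕ} (hi : i < 2 * a + b + 2 * c + d + e) :
    (i < a ∧ inflate a b c d e i + i + 1 = 2 * a + b + c + d) ∨
    (a ≤ i ∧ i < a + b ∧ inflate a b c d e i + i + 1 = 2 * a + b) ∨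
    (a + b ≤ i ∧ i < a + b + c ∧
      inflate a b c d e i + i + 1 = 3 * a + 2 * b + 2 * c + d + e) ∨
    (a + b + c ≤ i ∧ i < a + b + c + d ∧ inflate a b c d e i + i + 1 = 2 * (a + b + c) + d) ∨
    (a + b + c + d ≤ i ∧ i < 2 * a + b + c + d ∧
      inflate a b c d e i + i + 1 = 2 * a + b + c + d) ∨
    (2 * a + b + c + d ≤ i ∧ i < 2 * a + b + c + d + e ∧
      inflate a b c d e i + i + 1 = 2 * (2 * a + b + c + d) + e) ∨
    (2 * a + b + c + d + e ≤ i ∧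
      inflate a b c d e i + i + 1 = 3 * a + 2 * b + 2 * c + d + e) := by
  unfold inflate
  split_ifs <;> omega

theorem inflate_of_le {i : ℕ} (hi : 2 * a + b + 2 * c + d + e ≤ i) : inflate a b c d e i = i := by
  unfold inflate
  split_ifs <;> omega

theorem isInvol_inflate (a b c d e : ℕ) :
    IsInvol (inflate a b c d e) (2 * a + b + 2 * c + d + e) := by
  refine ⟨fun i => ?_, fun i hi => inflate_of_le hi⟩
  by_cases hi : i < 2 * a + b + 2 * c + d + e
  · have hj : inflate a b c d e i < 2 * a + b + 2 * c + d + e := by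
      have := inflate_cases a b c d e hi
      omega
    rcases inflate_cases a b c d e hi with h | h | h | h | h | h | h <;>
    rcases inflate_cases a b c d e hj with h' | h' | h' | h' | h' | h' | h' <;> omega
  · rw [inflate_of_le (i := i) (by omega), inflate_of_le (by omega)]

/-- The only `123` in `5274163` is `246`. Past the position bound no value is below `a + b`, so no
entry can complete a `2341`. -/
theorem inflate_increasing {x y z : ℕ} (hxy : x < y) (hyz : y < z)
    (hz : z < 2 * a + b + 2 * c + d + e) (h1 : inflate a b c d e x < inflate a b c d e y)
    (h2 : inflate a b c d e y < inflate a b c d e z) :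
    inflate a b c d e x < a + b ∧ 2 * a + b + c + d ≤ z := by
  have hx' := inflate_cases a b c d e (show x < 2 * a + b + 2 * c + d + e by omega)
  have hy' := inflate_cases a b c d e (show y < 2 * a + b + 2 * c + d + e by omega)
  have hz' := inflate_cases a b c d e hz
  rcases hy' with h | h | h | h | h | h | h <;>
  first
  | (exfalso; rcases hx' with h' | h' | h' | h' | h' | h' | h' <;> omega)
  | (exfalso; rcases hz' with h' | h' | h' | h' | h' | h' | h' <;> omega)
  | (constructor
     · rcases hx' with h' | h' | h' | h' | h' | h' | h' <;> omega
     · rcases hz' with h' | h' | h' | h' | h' | h' | h' <;> omega)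

theorem inflate_mem (ha : 0 < a) (hb : 0 < b) (hc : 0 < c) (hd : 0 < d) (he : 0 < e) :
    inflate a b c d e ∈ indecInvol (2 * a + b + 2 * c + d + e) ∧
      ¬ Avoids123 (inflate a b c d e) (2 * a + b + 2 * c + d + e) := by
  have hI := isInvol_inflate a b c d e
  have h0 := inflate_cases a b c d e (show 0 < 2 * a + b + 2 * c + d + e by omega)
  have hl := inflate_cases a b c d e (show a + b < 2 * a + b + 2 * c + d + e by omega)
  refine ⟨⟨by omega, ⟨hI, ?_⟩, ?_⟩, ?_⟩
  · intro x y z w h1 h2 h3 h4 h5 h6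
    have hw : w < 2 * a + b + 2 * c + d + e := by
      by_contra hw
      rw [hI.eq_self (i := w) (by omega)] at h4
      by_cases hx : x < 2 * a + b + 2 * c + d + e
      · have := hI.lt hx; omega
      · rw [hI.eq_self (by omega)] at h4; omega
    obtain ⟨h7, h8⟩ := inflate_increasing h1 h2 (by omega) h5 h6
    have := inflate_cases a b c d e hw
    omega
  · intro j hj hjn
    -- The crossing arcs from `0` and from `a + b` (which ends at the last position) together pass
    -- over every cut.
    rcases Nat.lt_or_ge j (2 * a + b + c + d) with h | h
    · exact ⟨0, hj, by omega⟩
    · exact ⟨a + b, by omega, by omega⟩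
  · intro h
    -- The first positions of the blocks of lengths `b`, `d`, `e` form a `123`.
    have h1 := inflate_cases a b c d e (show a < 2 * a + b + 2 * c + d + e by omega)
    have h2 := inflate_cases a b c d e (show a + b + c < 2 * a + b + 2 * c + d + e by omega)
    have h3 := inflate_cases a b c d e
      (show 2 * a + b + c + d < 2 * a + b + 2 * c + d + e by omega)
    exact h a (a + b + c) (2 * a + b + c + d) (by omega) (by omega) (by omega) (by omega) (by omega)

theorem inflate_inj {a' b' c' d' e' : ℕ} (ha : 0 < a) (hb : 0 < b) (hc : 0 < c) (hd : 0 < d)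
    (he : 0 < e) (ha' : 0 < a') (hb' : 0 < b') (hc' : 0 < c') (hd' : 0 < d') (he' : 0 < e')
    (hn : 2 * a + b + 2 * c + d + e = 2 * a' + b' + 2 * c' + d' + e')
    (h : inflate a b c d e = inflate a' b' c' d' e') :
    a = a' ∧ b = b' ∧ c = c' ∧ d = d' ∧ e = e' := by
  have key : ∀ i < 2 * a + b + 2 * c + d + e, _ := fun i hi =>
    And.intro (inflate_cases a b c d e hi) (inflate_cases a' b' c' d' e' (hn ▸ hi))
  rw [h] at key
  have h1 := key 0 (by omega)
  have h2 := key (2 * a + b + 2 * c + d + e - 1) (by omega)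
  have h3 : 2 * a + b + c + d = 2 * a' + b' + c' + d' := by omega
  have h4 : a + b = a' + b' := by omega
  have h5 := key a (by omega)
  have h6 := key a' (by omega)
  have h7 := key (2 * a + b + c + d) (by omega)
  have h8 : a = a' := by omega
  have h9 : e = e' := by omega
  omega

end inflate

/-! ### Indecomposables containing `123` are inflations of `5274163` -/

theorem length_eq_of_swap {f : ℕ → ℕ} {n p l q m : ℕ} (hf : IsInvol f n)
    (h1 : ∀ i, p ≤ i → i < p + l → q ≤ f i ∧ f i < q + m)
    (h2 : ∀ i, q ≤ i → i < q + m → p ≤ f i ∧ f i < p + l) : l = m := by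
  have key : ∀ {p l q m : ℕ}, (∀ i, p ≤ i → i < p + l → q ≤ f i ∧ f i < q + m) → l ≤ m := by
    intro p l q m h
    have := Finset.card_le_card_of_injOn (s := Finset.Ico p (p + l)) (t := Finset.Ico q (q + m)) f
      (fun i hi => by
        rw [Finset.mem_coe, Finset.mem_Ico] at hi
        rw [Finset.mem_coe, Finset.mem_Ico]
        exact h i hi.1 hi.2) (fun i _ j _ e => hf.inj e)
    rw [Nat.card_Ico, Nat.card_Ico] at this
    omega
  exact le_antisymm (key h1) (key h2)

theorem avoids4123 {f : ℕ → ℕ} {n : ℕ} (hf : f ∈ avInvol n) {a b c d : ℕ} (h1 : a < b)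
    (h2 : b < c) (h3 : c < d) (h4 : f b < f c) (h5 : f c < f d) (h6 : f d < f a) : False :=
  hf.2 (f b) (f c) (f d) (f a) h4 h5 h6 (by simpa only [hf.1.invol]) (by simpa only [hf.1.invol])
    (by simpa only [hf.1.invol])

/-- The first and the last arc of a sum-indecomposable `2341`-avoiding involution containing `123`
cross, and all arcs over the right end of the first arc are nested. -/
theorem exists_crossing {n : ℕ} {f : ℕ → ℕ} (hf : f ∈ indecInvol n) (h123 : ¬ Avoids123 f n) :
    ∃ k l, 0 < l ∧ l < k ∧ k < n - 1 ∧ f 0 = k ∧ f k = 0 ∧ f l = n - 1 ∧ f (n - 1) = l ∧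
      ∀ i j, i < j → j < k → k < f i → f j < f i := by
  obtain ⟨hn, hav, hind⟩ := hf
  have hI := hav.1
  unfold Avoids123 at h123
  push Not at h123
  obtain ⟨x, y, z, hxy, hyz, hzn, hfxy, hfyz, -⟩ := h123
  obtain ⟨k, hk⟩ : ∃ k, f 0 = k := ⟨_, rfl⟩
  have hk' : f k = 0 := by rw [← hk, hI.invol]
  have hkn : k < n := hk ▸ hI.lt hn
  have hk0 : 0 < k := by
    obtain ⟨i, hi, hi'⟩ := hind 1 one_pos (by omega)
    obtain rfl : i = 0 := by omega
    omega
  -- If the arc at `0` reached `n - 1`, inverting the `123` would give increasing values followed by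
  -- the final value `0`, a `2341`.
  have hkn1 : k < n - 1 := by
    by_contra hc
    obtain rfl : k = n - 1 := by omega
    have hx0 : x ≠ 0 := by
      rintro rfl
      have := hI.lt (show y < n by omega)
      omega
    have hz1 : f z < n - 1 := by
      have := hI.lt hzn
      have : f z ≠ n - 1 := fun e => by
        have := hI.inj (e.trans hk.symm)
        omega
      omega
    exact hav.2 (f x) (f y) (f z) (n - 1) hfxy hfyz hz1 (by rw [hI.invol]; omega)
      (by simpa only [hI.invol]) (by simpa only [hI.invol])
  -- Otherwise the positions `0, i, j, k` form a `2341`.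
  have hdec : ∀ i j, i < j → j < k → k < f i → f j < f i := by
    intro i j hij hjk hi
    by_contra hc
    have : f i ≠ f j := fun e => by have := hI.inj e; omega
    have hi0 : i ≠ 0 := by rintro rfl; omega
    exact hav.2 0 i j k (by omega) hij hjk (by omega) (by omega) (by omega)
  -- Take the leftmost `i < k` with `f i > k`. If `f i < n - 1`, the cut after `f i` is crossed from
  -- some `j` with `k < j < f i`, and `0, i, j, f i` is a `2341`.
  obtain ⟨l, hl0, hlk, hl⟩ : ∃ l, 0 < l ∧ l < k ∧ f l = n - 1 := by
    have hex : ∃ i, i < k ∧ k < f i := by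
      obtain ⟨i, hi, hi'⟩ := hind (k + 1) (by omega) (by omega)
      have : i ≠ k := by rintro rfl; omega
      exact ⟨i, by omega, by omega⟩
    classical
    obtain ⟨hik, hki⟩ := Nat.find_spec hex
    have hmin : ∀ j, j < Nat.find hex → ¬ (j < k ∧ k < f j) := fun j hj => Nat.find_min hex hj
    generalize Nat.find hex = i at hik hki hmin
    have hi0 : i ≠ 0 := by rintro rfl; omega
    refine ⟨i, by omega, hik, ?_⟩
    have hin := hI.lt (show i < n by omega)
    by_contra hc
    obtain ⟨j, hj, hj'⟩ := hind (f i + 1) (by omega) (by omega)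
    have hj1 : j ≠ f i := by rintro rfl; rw [hI.invol] at hj'; omega
    have hj2 : j ≠ k := by rintro rfl; omega
    have hj3 : ¬ j < k := by
      intro hjk
      have h1 := hmin j
      have h2 : j ≠ i := by rintro rfl; omega
      rcases Nat.lt_or_gt_of_ne h2 with h | h
      · exact h1 h ⟨hjk, by omega⟩
      · have := hdec i j h hjk hki
        omega
    exact hav.2 0 i j (f i) (by omega) (by omega) (by omega) (by rw [hI.invol]; omega) (by omega)
      (by omega)
  exact ⟨k, l, hl0, hlk, hkn1, hk, hk', hl, by rw [← hl, hI.invol], hdec⟩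

/-- The arcs `(0, k)` and `(l, n - 1)` force decrease before `l` and after `k`. A fixed `123`, with
middle position `y`, cuts `[l, k]` into three intervals: one swapped with the final block, one
preserved, one swapped with the initial block. Decreasing bijections of intervals are reversals. -/
theorem exists_eq_inflate {n : ℕ} {f : ℕ → ℕ} (hf : f ∈ indecInvol n) (h123 : ¬ Avoids123 f n) :
    ∃ a b c d e, 0 < a ∧ 0 < b ∧ 0 < c ∧ 0 < d ∧ 0 < e ∧ 2 * a + b + 2 * c + d + e = n ∧
      inflate a b c d e = f := by
  obtain ⟨k, l, hl0, hlk, hkn, hk, hk', hl, hl', hdec⟩ := exists_crossing hf h123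
  obtain ⟨hn, hav, -⟩ := hf
  have hI := hav.1
  have ne : ∀ {i j}, i ≠ j → f i ≠ f j := fun hij e => hij (hI.inj e)
  have lt : ∀ {i}, i < n → f i < n := fun hi => hI.lt hi
  -- The entry `0` at position `k` would complete a `2341`.
  have left : ∀ a b c, 0 < a → a < b → b < c → c < k → f a < f b → f b < f c → False := by
    intro a b c h0 h1 h2 h3 h4 h5
    have := ne (show a ≠ k by omega)
    exact hav.2 a b c k h1 h2 h3 (by omega) h4 h5
  -- The entry `n - 1` at position `l` would complete a `4123`.
  have right : ∀ a b c, l < a → a < b → b < c → c < n → f a < f b → f b < f c → False := by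
    intro a b c h0 h1 h2 h3 h4 h5
    have := ne (show c ≠ l by omega)
    have := lt h3
    exact avoids4123 hav h0 h1 h2 h4 h5 (by omega)
  have dec1 : ∀ i j, i < j → j < l → f j < f i := by
    intro i j hij hj
    by_contra hc
    have h1 := ne (show i ≠ j by omega)
    have h2 := ne (show j ≠ l by omega)
    have h3 := lt (show j < n by omega)
    rcases Nat.eq_zero_or_pos i with rfl | hi
    · have := hdec j l hj hlk (by omega)
      omega
    · exact left i j l hi hij hj hlk (by omega) (by omega)
  have dec2 : ∀ i j, k < i → i < j → j < n → f j < f i := by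
    intro i j hi hij hj
    by_contra hc
    have h1 := ne (show i ≠ j by omega)
    have h2 := ne (show i ≠ k by omega)
    rcases Nat.lt_or_ge j (n - 1) with hj' | hj'
    · exact right k i j hlk hi hij hj (by omega) (by omega)
    · obtain rfl : j = n - 1 := by omega
      have := hdec (f i) l (by omega) hlk (by rw [hI.invol]; exact hi)
      rw [hI.invol] at this
      omega
  have tri : ∀ x y z, x < y → y < z → z < n → f x < f y → f y < f z →
      x < l ∧ l < y ∧ y < k ∧ k < z := by
    intro x y z h1 h2 h3 h4 h5
    have hx : x < l := by
      by_contra hc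
      have hy := lt (show y < n by omega)
      have : x ≠ l := by rintro rfl; omega
      exact right x y z (by omega) h1 h2 h3 h4 h5
    have hz : k < z := by
      by_contra hc
      have : z ≠ k := by rintro rfl; omega
      rcases Nat.eq_zero_or_pos x with rfl | hx0
      · have := hdec y z h2 (by omega) (by omega)
        omega
      · exact left x y z hx0 h1 h2 (by omega) h4 h5
    have hy1 : l < y := by
      by_contra hc
      have := lt h3
      have : y ≠ l := by rintro rfl; omega
      have := dec1 x y h1 (by omega)
      omega
    have hy2 : y < k := by
      by_contra hc
      have : y ≠ k := by rintro rfl; omega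
      have := dec2 y z (by omega) h2 h3
      omega
    exact ⟨hx, hy1, hy2, hz⟩
  unfold Avoids123 at h123
  push Not at h123
  obtain ⟨x, y, z, hxy, hyz, hzn, hfxy, hfyz, -⟩ := h123
  obtain ⟨hx, hy, hy', hz⟩ := tri x y z hxy hyz hzn hfxy hfyz
  -- The inverted triple is also a `123`, so its values are located like its positions.
  obtain ⟨hfx, hfy, hfy', hfz⟩ := tri (f x) (f y) (f z) hfxy hfyz (lt hzn)
    (by simpa only [hI.invol]) (by simpa only [hI.invol])
  -- the end of the first block
  obtain ⟨a, hal, hfal, hamin⟩ : ∃ a, a ≤ x ∧ f a < l ∧ ∀ i < a, l ≤ f i := by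
    classical
    have hex : ∃ i, f i < l := ⟨x, hfx⟩
    exact ⟨Nat.find hex, Nat.find_min' hex hfx, Nat.find_spec hex, fun i hi => by
      have := Nat.find_min hex hi
      omega⟩
  have ha0 : 0 < a := by
    rcases Nat.eq_zero_or_pos a with rfl | h
    · omega
    · exact h
  have low : ∀ i, i < l → f i ≤ k := by
    intro i hi
    rcases Nat.eq_zero_or_pos i with rfl | h
    · omega
    · have := dec1 0 i h hi
      omega
  have blockA : ∀ i, i < a → l < f i ∧ f i ≤ k := by
    intro i hi
    have h1 := hamin i hi
    have h2 := ne (show i ≠ n - 1 by omega)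
    exact ⟨by omega, low i (by omega)⟩
  have blockB : ∀ i, a ≤ i → i < l → a ≤ f i ∧ f i < l := by
    intro i hi hil
    have h1 : f i < l := by
      rcases Nat.eq_or_lt_of_le hi with rfl | h
      · exact hfal
      · have := dec1 a i h hil
        omega
    refine ⟨?_, h1⟩
    by_contra hc
    have := hamin (f i) (by omega)
    rw [hI.invol] at this
    omega
  -- the start of the last block
  obtain ⟨q, hkq, hqn, hfq, hqmin⟩ : ∃ q, k < q ∧ q < n ∧ f q < k ∧ ∀ i, k < i → i < q → k < f i := by
    classical
    have hex : ∃ i, k < i ∧ f i < k := ⟨n - 1, hkn, by omega⟩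
    have hle : Nat.find hex ≤ n - 1 := Nat.find_min' hex ⟨hkn, by omega⟩
    refine ⟨Nat.find hex, (Nat.find_spec hex).1, by omega, (Nat.find_spec hex).2, ?_⟩
    intro i hi hiq
    have h1 := Nat.find_min hex hiq
    have h2 := ne (show i ≠ 0 by omega)
    omega
  have blockC : ∀ i, q ≤ i → i < n → l ≤ f i ∧ f i < k := by
    intro i hi hin
    refine ⟨?_, ?_⟩
    · by_contra hc
      have := low (f i) (by omega)
      rw [hI.invol] at this
      omega
    · rcases Nat.eq_or_lt_of_le hi with rfl | h
      · exact hfq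
      · have := dec2 q i hkq h hin
        omega
  have blockE : ∀ i, k < i → i < q → k < f i ∧ f i < q := by
    intro i hi hiq
    refine ⟨hqmin i hi hiq, ?_⟩
    by_contra hc
    have := blockC (f i) (by omega) (lt (by omega))
    rw [hI.invol] at this
    omega
  have hzq : z < q := by
    by_contra hc
    have := blockC z (by omega) hzn
    omega
  -- the three blocks in the middle
  have mid : ∀ u, l ≤ u → u ≤ k → f u < a ∨ (l ≤ f u ∧ f u ≤ k) ∨ (q ≤ f u ∧ f u < n) := by
    intro u hu huk
    have h1 := blockB (f u)
    have h2 := blockE (f u)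
    rw [hI.invol] at h1 h2
    have := lt (show u < n by omega)
    omega
  -- An ascent here would make `x, u, v` a `123` to the left of `k`.
  have midDec : ∀ u v, l ≤ u → u < v → v ≤ k → l ≤ f u → f u ≤ k → l ≤ f v → f v < f u := by
    intro u v hu huv hv hfu hfu' hfv
    by_contra hc
    have h1 := ne (show u ≠ v by omega)
    have h2 : v ≠ k := by rintro rfl; omega
    have h3 := (blockB x hal hx).2
    exact left x u v (by omega) (by omega) huv (by omega) (by omega) (by omega)
  -- Otherwise `u, v, z` would be a `123` to the right of `l`.
  have midA : ∀ u v, l ≤ u → u < v → v ≤ k → l ≤ f v → f v ≤ k → l ≤ f u := by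
    intro u v hu huv hv hfv hfv'
    by_contra hc
    have h2 : u ≠ l := by rintro rfl; omega
    exact right u v z (by omega) huv (by omega) hzn (by omega) (by omega)
  have hA : ∀ w, l ≤ w → w ≤ k → f w < a → y < w := by
    intro w h1 h2 h3
    by_contra hc
    have : w ≠ y := by rintro rfl; omega
    have := midA w y h1 (by omega) (by omega) (by omega) (by omega)
    omega
  have hC : ∀ w, l ≤ w → w ≤ k → q ≤ f w → w < y := by
    intro w h1 h2 h3
    by_contra hc
    have : w ≠ y := by rintro rfl; omega
    have := midDec y w (by omega) (by omega) h2 (by omega) (by omega) (by omega)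
    omega
  -- The middle splits as `[l, s]`, `(s, r)`, `[r, k]`: the image of `[q, n)`, a preserved interval,
  -- and the image of `[0, a)`.
  obtain ⟨r, hr⟩ : ∃ r, f (a - 1) = r := ⟨_, rfl⟩
  obtain ⟨s, hs⟩ : ∃ s, f q = s := ⟨_, rfl⟩
  have hr' : f r = a - 1 := by rw [← hr, hI.invol]
  have hs' : f s = q := by rw [← hs, hI.invol]
  have hrk := blockA (a - 1) (by omega)
  have hsk := blockC q le_rfl hqn
  have hyr := hA r (by omega) (by omega) (by omega)
  have hsy := hC s (by omega) (by omega) (by omega)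
  have rangeA : ∀ i, i < a → r ≤ f i := by
    intro i hi
    rcases Nat.lt_or_ge i (a - 1) with h | h
    · have := dec1 i (a - 1) h (by omega)
      omega
    · obtain rfl : i = a - 1 := by omega
      omega
  have rangeC : ∀ i, q ≤ i → i < n → f i ≤ s := by
    intro i hi hin
    rcases Nat.eq_or_lt_of_le hi with rfl | h
    · omega
    · have := dec2 q i hkq h hin
      omega
  have blockA' : ∀ w, r ≤ w → w ≤ k → f w < a := by
    intro w h1 h2
    rcases mid w (by omega) h2 with h | h | h
    · exact h
    · rcases Nat.eq_or_lt_of_le h1 with rfl | h3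
      · omega
      · have := midA r w (by omega) h3 h2 h.1 h.2
        omega
    · have := hC w (by omega) h2 h.1
      omega
  have blockC' : ∀ w, l ≤ w → w ≤ s → q ≤ f w ∧ f w < n := by
    intro w h1 h2
    rcases mid w h1 (by omega) with h | h | h
    · have := hA w h1 (by omega) h
      omega
    · rcases Nat.eq_or_lt_of_le h2 with rfl | h3
      · omega
      · have := midDec w s (by omega) h3 (by omega) h.1 h.2 (by omega)
        omega
    · exact h
  have blockD : ∀ w, s < w → w < r → s < f w ∧ f w < r := by
    intro w h1 h2
    have h3 := rangeA (f w)
    have h4 := rangeC (f w)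
    have h5 := blockA' (f w)
    have h6 := blockC' (f w)
    rw [hI.invol] at h3 h4 h5 h6
    have := mid w (by omega) (by omega)
    omega
  have lenA := length_eq_of_swap (p := 0) (l := a) (q := r) (m := k + 1 - r) hI
    (fun i _ hi => ⟨rangeA i (by omega), by have := blockA i (by omega); omega⟩)
    (fun i hi hi' => ⟨Nat.zero_le _, by have := blockA' i hi (by omega); omega⟩)
  have lenC := length_eq_of_swap (p := q) (l := n - q) (q := l) (m := s + 1 - l) hI
    (fun i hi hi' => ⟨(blockC i hi (by omega)).1, by have := rangeC i hi (by omega); omega⟩)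
    (fun i hi hi' => ⟨(blockC' i hi (by omega)).1, by have := blockC' i hi (by omega); omega⟩)
  have valA : ∀ i, i < a → f i + i = k := by
    intro i hi
    have := add_eq_of_decreasing (f := f) (p := 0) (q := r) (l := a)
      (fun i j _ hij hj => dec1 i j hij (by omega))
      (fun i _ hi => ⟨rangeA i (by omega), by have := blockA i (by omega); omega⟩)
      (Nat.zero_le i) (by omega)
    omega
  have valB : ∀ i, a ≤ i → i < l → f i + i + 1 = a + l := by
    intro i hi hi'
    have := add_eq_of_decreasing (f := f) (p := a) (q := a) (l := l - a)
      (fun i j _ hij hj => dec1 i j hij (by omega))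
      (fun i hi hi' => by have := blockB i hi (by omega); omega) hi (by omega)
    omega
  have valC : ∀ i, q ≤ i → i < n → f i + i + 1 = l + n := by
    intro i hi hi'
    have := add_eq_of_decreasing (f := f) (p := q) (q := l) (l := n - q)
      (fun i j h hij hj => dec2 i j (by omega) hij (by omega))
      (fun i hi hi' => ⟨(blockC i hi (by omega)).1, by have := rangeC i hi (by omega); omega⟩)
      hi (by omega)
    omega
  have valD : ∀ i, s < i → i < r → f i + i = s + r := by
    intro i hi hi'
    have := add_eq_of_decreasing (f := f) (p := s + 1) (q := s + 1) (l := r - s - 1)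
      (fun i j h hij hj => by
        have := blockD i (by omega) (by omega)
        have := blockD j (by omega) (by omega)
        exact midDec i j (by omega) hij (by omega) (by omega) (by omega) (by omega))
      (fun i hi hi' => by have := blockD i hi (by omega); omega) hi (by omega)
    omega
  have valE : ∀ i, k < i → i < q → f i + i = k + q := by
    intro i hi hi'
    have := add_eq_of_decreasing (f := f) (p := k + 1) (q := k + 1) (l := q - k - 1)
      (fun i j h hij hj => dec2 i j (by omega) hij (by omega))
      (fun i hi hi' => by have := blockE i hi (by omega); omega) hi (by omega)
    omega
  have valA' : ∀ i, r ≤ i → i ≤ k → f i + i = k := by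
    intro i hi hi'
    have := valA (f i) (blockA' i hi hi')
    rw [hI.invol] at this
    omega
  have valC' : ∀ i, l ≤ i → i ≤ s → f i + i + 1 = l + n := by
    intro i hi hi'
    have h := blockC' i hi hi'
    have := valC (f i) h.1 h.2
    rw [hI.invol] at this
    omega
  refine ⟨a, l - a, s + 1 - l, r - s - 1, q - k - 1, ha0, by omega, by omega, by omega, by omega,
    by omega, ?_⟩
  funext i
  have hlen : 2 * a + (l - a) + 2 * (s + 1 - l) + (r - s - 1) + (q - k - 1) = n := by omega
  by_cases hi : i < n
  · rcases inflate_cases a (l - a) (s + 1 - l) (r - s - 1) (q - k - 1) (hlen.symm ▸ hi) with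
      h | h | h | h | h | h | h
    · have := valA i (by omega)
      omega
    · have := valB i (by omega) (by omega)
      omega
    · have := valC' i (by omega) (by omega)
      omega
    · have := valD i (by omega) (by omega)
      omega
    · have := valA' i (by omega) (by omega)
      omega
    · have := valE i (by omega) (by omega)
      omega
    · have := valC i (by omega) (by omega)
      omega
  · rw [inflate_of_le (by omega), hI.eq_self (by omega)]

/-- The sum-indecomposable `2341`-avoiding involutions that contain `123` are counted by the sizes
of the blocks of an inflation. -/
theorem ncard_indec_contains123 (n : ℕ) :
    ({f ∈ indecInvol n | ¬ Avoids123 f n}).ncard =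
      Nat.card {p : ℕ × ℕ × ℕ × ℕ × ℕ // 2 * (p.1 + 1) + (2 * (p.2.1 + 1) +
        ((p.2.2.1 + 1) + ((p.2.2.2.1 + 1) + (p.2.2.2.2 + 1)))) = n} := by
  rw [← Nat.card_coe_set_eq]
  symm
  refine Nat.card_eq_of_bijective (fun p => ⟨inflate (p.1.1 + 1) (p.1.2.2.1 + 1) (p.1.2.1 + 1)
    (p.1.2.2.2.1 + 1) (p.1.2.2.2.2 + 1), ?_⟩) ⟨?_, ?_⟩
  · have := inflate_mem (a := p.1.1 + 1) (b := p.1.2.2.1 + 1) (c := p.1.2.1 + 1)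
      (d := p.1.2.2.2.1 + 1) (e := p.1.2.2.2.2 + 1) (by omega) (by omega) (by omega) (by omega)
      (by omega)
    rwa [show 2 * (p.1.1 + 1) + (p.1.2.2.1 + 1) + 2 * (p.1.2.1 + 1) + (p.1.2.2.2.1 + 1) +
      (p.1.2.2.2.2 + 1) = n by have := p.2; omega] at this
  · rintro ⟨⟨a, c, b, d, e⟩, h⟩ ⟨⟨a', c', b', d', e'⟩, h'⟩ heq
    dsimp only at h h'
    have heq' : inflate (a + 1) (b + 1) (c + 1) (d + 1) (e + 1) =
        inflate (a' + 1) (b' + 1) (c' + 1) (d' + 1) (e' + 1) := congrArg Subtype.val heq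
    obtain ⟨h1, h2, h3, h4, h5⟩ := inflate_inj (by omega) (by omega) (by omega) (by omega)
      (by omega) (by omega) (by omega) (by omega) (by omega) (by omega) (by omega)
      heq'
    simp only [Subtype.mk.injEq, Prod.mk.injEq]
    omega
  · rintro ⟨f, hf, h123⟩
    obtain ⟨a, b, c, d, e, ha, hb, hc, hd, he, hn, rfl⟩ := exists_eq_inflate hf h123
    refine ⟨⟨(a - 1, c - 1, b - 1, d - 1, e - 1), by dsimp only; omega⟩, Subtype.ext ?_⟩
    dsimp only
    congr 1 <;> omega

open PowerSeries

/-! ### Generating functions -/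

/-- The generating function of the central binomial coefficients of all rows. -/
noncomputable def centralGF : PowerSeries ℝ := mk fun n => (n.choose (n / 2) : ℝ)

/-- The generating function of the Catalan numbers in the variable `X ^ 2`. -/
noncomputable def catalanGF : PowerSeries ℝ :=
  expand 2 two_ne_zero (catalanSeries.map (Nat.castRingHom ℝ))

theorem catalanGF_eq : catalanGF = catalanGF ^ 2 * X ^ 2 + 1 := by
  have h := congrArg (fun f => expand 2 two_ne_zero (PowerSeries.map (Nat.castRingHom ℝ) f))
    catalanSeries_sq_mul_X_add_one
  simp only [map_add, map_mul, map_pow, map_one, PowerSeries.map_X, expand_X] at h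
  exact h.symm

theorem coeff_catalanGF_even (m : ℕ) : coeff (2 * m) catalanGF = (catalan m : ℝ) := by
  rw [catalanGF, coeff_expand_mul, PowerSeries.coeff_map, catalanSeries_coeff]
  rfl

theorem coeff_catalanGF_odd (m : ℕ) : coeff (2 * m + 1) catalanGF = 0 :=
  coeff_expand_of_not_dvd _ _ _ (by omega)

theorem choose_odd_half (m : ℕ) :
    (2 * m + 1).choose m + catalan m = 2 * (2 * m).choose m := by
  have h1 : (2 * m + 1).choose m = (2 * m).choose m + (2 * m).choose (m + 1) := by
    rw [← Nat.choose_succ_succ', ← Nat.choose_symm (by omega)]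
    congr 1
    omega
  have h2 := succ_mul_catalan_eq_centralBinom m
  rw [Nat.centralBinom_eq_two_mul_choose] at h2
  have h3 := Nat.choose_succ_right_eq (2 * m) m
  rw [show 2 * m - m = m by omega] at h3
  have h4 : (m + 1) * ((2 * m).choose (m + 1) + catalan m) = (m + 1) * (2 * m).choose m := by
    rw [mul_add, h2, mul_comm (m + 1), h3]
    ring
  have h5 := Nat.eq_of_mul_eq_mul_left (Nat.succ_pos m) h4
  omega

theorem choose_even_half (m : ℕ) :
    (2 * m + 2).choose (m + 1) = 2 * (2 * m + 1).choose m := by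
  rw [Nat.choose_succ_succ' (2 * m + 1) m, ← Nat.choose_symm_half]
  ring

/-- Each central coefficient doubles the previous one, except that passing from row `2m` to row `2m
+ 1` loses `catalan m`. -/
theorem one_sub_two_X_mul_centralGF : (1 - 2 * X) * centralGF = 1 - X * catalanGF := by
  ext n
  rw [sub_mul, one_mul, mul_assoc, two_mul, map_sub, map_add, map_sub]
  cases n with
  | zero => simp [centralGF]
  | succ n =>
    simp only [coeff_succ_X_mul, coeff_one, Nat.succ_ne_zero, if_false, centralGF, coeff_mk]
    rcases Nat.even_or_odd' n with ⟨m, rfl | rfl⟩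
    · rw [coeff_catalanGF_even, show (2 * m + 1) / 2 = m by omega, show 2 * m / 2 = m by omega]
      have := choose_odd_half m
      have : ((2 * m + 1).choose m : ℝ) + catalan m = 2 * (2 * m).choose m := by exact_mod_cast this
      linarith
    · rw [coeff_catalanGF_odd, show (2 * m + 1 + 1) / 2 = m + 1 by omega,
        show (2 * m + 1) / 2 = m by omega]
      have : ((2 * m + 1 + 1).choose (m + 1) : ℝ) = 2 * (2 * m + 1).choose m := by
        exact_mod_cast choose_even_half m
      linarith

theorem one_sub_two_X_ne_zero : (1 - 2 * X : PowerSeries ℝ) ≠ 0 := by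
  intro h
  simpa using congrArg constantCoeff h

/-- Eliminate the Catalan series through its quadratic equation and cancel `1 - 2X`. -/
theorem centralGF_quadratic :
    centralGF * (1 - 2 * X) * (1 + X * centralGF) = (1 : PowerSeries ℝ) := by
  have h1 := one_sub_two_X_mul_centralGF
  have h2 := catalanGF_eq
  refine mul_left_cancel₀ one_sub_two_X_ne_zero ?_
  linear_combination ((1 - 2 * X) + X * ((1 - 2 * X) * centralGF + (1 - X * catalanGF))) * h1 -
    X * h2

/-- The geometric series. -/
noncomputable def geomGF : PowerSeries ℝ := mk 1

/-- The alternating geometric series. -/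
noncomputable def altGF : PowerSeries ℝ := mk fun n => (-1) ^ n

theorem geomGF_mul : geomGF * (1 - X) = 1 := mk_one_mul_one_sub_eq_one ℝ

theorem altGF_mul : altGF * (1 + X) = 1 := by
  ext n
  rw [mul_add, mul_one, map_add]
  cases n with
  | zero => simp [altGF]
  | succ n =>
    simp only [coeff_succ_mul_X, coeff_one, Nat.succ_ne_zero, if_false, altGF, coeff_mk]
    ring

theorem expand_geomGF : expand 2 two_ne_zero geomGF = geomGF * altGF := by
  have h := congrArg (expand 2 two_ne_zero) geomGF_mul
  rw [map_mul, map_sub, map_one, expand_X] at h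
  have h1 := geomGF_mul
  have h2 := altGF_mul
  linear_combination (geomGF * altGF) * h - (expand 2 two_ne_zero geomGF) *
    (altGF * (1 + X) * h1 + h2)

theorem weightGF_add_one : weightGF (fun a : ℕ => a + 1) = X * geomGF := by
  ext n
  simp only [weightGF, coeff_mk]
  cases n with
  | zero => simp
  | succ n =>
    rw [coeff_succ_X_mul]
    simp [geomGF]

theorem weightGF_two_mul_add_one :
    weightGF (fun a : ℕ => 2 * (a + 1)) = X ^ 2 * (geomGF * altGF) := by
  rw [← expand_geomGF]
  ext n
  simp only [weightGF, coeff_mk, coeff_X_pow_mul']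
  split_ifs with hn
  · rcases Nat.even_or_odd' (n - 2) with ⟨m, hm | hm⟩
    · rw [hm, coeff_expand_mul]
      have : Unique {a // 2 * (a + 1) = n} :=
        ⟨⟨⟨m, by omega⟩⟩, fun a => Subtype.ext (by have := a.2; dsimp only; omega)⟩
      simp [geomGF]
    · rw [coeff_expand_of_not_dvd _ _ _ (by omega)]
      have : IsEmpty {a // 2 * (a + 1) = n} := ⟨fun a => by have := a.2; omega⟩
      simp
  · have : IsEmpty {a // 2 * (a + 1) = n} := ⟨fun a => by have := a.2; omega⟩
    simp

/-- Each of the two lengths used twice contributes `X²/(1-X²)`, each of the other three `X/(1-X)`.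
-/
theorem weightGF_blocks :
    weightGF (fun p : ℕ × ℕ × ℕ × ℕ × ℕ => 2 * (p.1 + 1) + (2 * (p.2.1 + 1) +
      ((p.2.2.1 + 1) + ((p.2.2.2.1 + 1) + (p.2.2.2.2 + 1))))) =
      X ^ 7 * geomGF ^ 5 * altGF ^ 2 := by
  have f1 : ∀ n, Finite {a : ℕ // a + 1 = n} := fun n =>
    Finite.of_injective (β := Fin n) (fun a => ⟨a.1, by omega⟩) fun a b h =>
      Subtype.ext (congrArg Fin.val h)
  have f2 : ∀ n, Finite {a : ℕ // 2 * (a + 1) = n} := fun n =>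
    Finite.of_injective (β := Fin n) (fun a => ⟨a.1, by omega⟩) fun a b h =>
      Subtype.ext (congrArg Fin.val h)
  have f3 := finite_weight_prod _ _ f1 f1
  have f4 := finite_weight_prod _ _ f1 f3
  have f5 := finite_weight_prod _ _ f2 f4
  rw [weightGF_prod _ _ f2 f5, weightGF_prod _ _ f2 f4, weightGF_prod _ _ f1 f3,
    weightGF_prod _ _ f1 f1, weightGF_add_one, weightGF_two_mul_add_one]
  ring

theorem setGF_indecInvol : setGF indecInvol =
    centralGF - 1 - X ^ 2 * geomGF ^ 2 + X ^ 7 * geomGF ^ 5 * altGF ^ 2 := by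
  rw [← weightGF_blocks]
  ext n
  rw [map_add, map_sub, map_sub]
  simp only [setGF, centralGF, weightGF, coeff_mk, coeff_one]
  rw [← ncard_indec_contains123]
  have hgeom : coeff n (X ^ 2 * geomGF ^ 2) = ((n - 1 : ℕ) : ℝ) := by
    rw [coeff_X_pow_mul', geomGF, mk_one_pow_eq_mk_choose_add]
    simp only [coeff_mk]
    split_ifs with h
    · rw [Nat.choose_one_right]
      congr 1
      omega
    · rw [show n - 1 = 0 by omega]
      simp
  rw [hgeom]
  have hfin : ∀ p : (ℕ → ℕ) → Prop, {f ∈ indecInvol n | p f}.Finite := fun p =>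
    (finite_indecInvol n).subset fun _ h => h.1
  have hsplit : (indecInvol n).ncard =
      ({f ∈ indecInvol n | Avoids123 f n}).ncard + ({f ∈ indecInvol n | ¬ Avoids123 f n}).ncard := by
    rw [← Set.ncard_union_eq _ (hfin _) (hfin _)]
    · congr 1
      ext f
      by_cases h : Avoids123 f n <;> simp [h]
    · rw [Set.disjoint_left]
      exact fun f h h' => h'.2 h.2
  rcases Nat.eq_zero_or_pos n with rfl | hn
  · have h : indecInvol 0 = ∅ := Set.eq_empty_iff_forall_notMem.2 fun f h => absurd h.1 (by omega)
    simp [h]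
  · rw [if_neg (by omega), hsplit]
    have h : (({f ∈ indecInvol n | Avoids123 f n}).ncard : ℝ) + ((n - 1 : ℕ) : ℝ) =
        (n.choose (n / 2) : ℝ) := by exact_mod_cast ncard_indec_avoids123 hn
    push_cast
    linarith

/-! ### The closed form of the generating function -/

theorem genFun_add_one : genFun {⟨4, perm2341⟩} + 1 = setGF avInvol := by
  ext n
  rw [map_add, coeff_one]
  simp only [genFun, setGF, coeff_mk]
  split_ifs with h
  · rw [h, ncard_avInvol_zero]
    simp
  · rw [ncard_avI, add_zero]

/-- The power series square root of `1 - 4 X ^ 2`. -/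
noncomputable def sqrtGF : PowerSeries ℝ := (1 - 2 * X) * (1 + 2 * X * centralGF)

/-- Completing the square in the quadratic for `centralGF`, whose discriminant is `(1-2X)² +
4X(1-2X) = 1 - 4X²`. -/
theorem isSqrtSeries_sqrtGF : IsSqrtSeries sqrtGF := by
  constructor
  · rw [sqrtGF]
    linear_combination (4 * X * (1 - 2 * X)) * centralGF_quadratic
  · simp [sqrtGF]

/-- The generating function of all `2341`-avoiding involutions, with denominators cleared. -/
theorem gf_equation :
    (2 * (1 - X) ^ 5 * (1 + X) ^ 2 + X ^ 2 * (1 - X) ^ 3 * (1 + X) ^ 2 - X ^ 7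
      - (1 - X) ^ 5 * (1 + X) ^ 2 * centralGF) * setGF avInvol =
      (1 - X) ^ 5 * (1 + X) ^ 2 := by
  have h1 := setGF_avInvol
  rw [setGF_indecInvol] at h1
  have h2 : ((1 - X) * geomGF) ^ 2 = 1 := by rw [mul_comm, geomGF_mul, one_pow]
  have h3 : ((1 - X) * geomGF) ^ 5 * ((1 + X) * altGF) ^ 2 = 1 := by
    rw [mul_comm, mul_comm (1 + X), altGF_mul, mul_comm (1 - X), geomGF_mul]; ring
  linear_combination ((1 - X) ^ 5 * (1 + X) ^ 2) * h1 +
    (-(X ^ 2 * (1 - X) ^ 3 * (1 + X) ^ 2) * h2 + X ^ 7 * h3) * setGF avInvol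

theorem coe_polyP : (polyP : PowerSeries ℝ) =
    1 - 8 * X + 17 * X ^ 2 + 24 * X ^ 3 - 151 * X ^ 4 + 162 * X ^ 5 + 221 * X ^ 6 - 624 * X ^ 7
    + 231 * X ^ 8 + 684 * X ^ 9 - 801 * X ^ 10 - 60 * X ^ 11 + 627 * X ^ 12 - 334 * X ^ 13
    - 101 * X ^ 14 + 158 * X ^ 15 - 48 * X ^ 16 := by
  rw [← Polynomial.coeToPowerSeries.ringHom_apply, polyP]
  simp only [map_sub, map_add, map_mul, map_pow, map_one, map_ofNat,
    Polynomial.coeToPowerSeries.ringHom_apply, Polynomial.coe_X]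

theorem coe_polyQ : (polyQ : PowerSeries ℝ) =
    1 - 6 * X + 4 * X ^ 2 + 50 * X ^ 3 - 141 * X ^ 4 + 55 * X ^ 5 + 326 * X ^ 6 - 514 * X ^ 7
    - 26 * X ^ 8 + 725 * X ^ 9 - 561 * X ^ 10 - 223 * X ^ 11 + 540 * X ^ 12 - 206 * X ^ 13
    - 113 * X ^ 14 + 120 * X ^ 15 - 32 * X ^ 16 := by
  rw [← Polynomial.coeToPowerSeries.ringHom_apply, polyQ]
  simp only [map_sub, map_add, map_mul, map_pow, map_one, map_ofNat,
    Polynomial.coeToPowerSeries.ringHom_apply, Polynomial.coe_X]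

theorem genFun_eq : genFun {⟨4, perm2341⟩} =
    ((X + 1) ^ 4 * (X - 1) ^ 10 * sqrtGF - (polyP : PowerSeries ℝ)) *
      (2 * (polyQ : PowerSeries ℝ))⁻¹ := by
  rw [PowerSeries.eq_mul_inv_iff_mul_eq (by rw [coe_polyQ]; simp [map_ofNat])]
  have hG : genFun {⟨4, perm2341⟩} = setGF avInvol - 1 := by rw [← genFun_add_one]; ring
  rw [hG, coe_polyP, coe_polyQ, sqrtGF]
  have h1 := gf_equation
  have h2 := centralGF_quadratic
  generalize setGF avInvol = G at h1 ⊢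
  have hne : (2 * (1 - X) ^ 5 * (1 + X) ^ 2 + X ^ 2 * (1 - X) ^ 3 * (1 + X) ^ 2 - X ^ 7
      - (1 - X) ^ 5 * (1 + X) ^ 2 * centralGF : PowerSeries ℝ) ≠ 0 := by
    intro h
    have h0 : constantCoeff centralGF = 1 := by
      rw [← coeff_zero_eq_constantCoeff_apply]; simp [centralGF]
    have := congrArg constantCoeff h
    simp [h0, map_ofNat] at this
    norm_num at this
  refine mul_left_cancel₀ hne ?_
  generalize centralGF = c at h1 h2 ⊢
  generalize (X : PowerSeries ℝ) = x at h1 h2 ⊢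
  -- With `D = (1-x)⁵(1+x)²`, the multipliers are `2q` for the equation of `A` and `2D³` for the
  -- quadratic of `C`; the factor `(x+1)⁴(x-1)¹⁰` is `D²`.
  linear_combination (2 * (1 - 6 * x + 4 * x ^ 2 + 50 * x ^ 3 - 141 * x ^ 4 + 55 * x ^ 5
    + 326 * x ^ 6 - 514 * x ^ 7 - 26 * x ^ 8 + 725 * x ^ 9 - 561 * x ^ 10 - 223 * x ^ 11
    + 540 * x ^ 12 - 206 * x ^ 13 - 113 * x ^ 14 + 120 * x ^ 15 - 32 * x ^ 16)) * h1 +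
    (2 * ((1 - x) ^ 5 * (1 + x) ^ 2) ^ 3) * h2

/-! ### Values of power series -/

/-- The power series `f` converges absolutely at `x`, with value `v`. -/
def HasEval (f : PowerSeries ℝ) (x v : ℝ) : Prop :=
  Summable (fun n => ‖coeff n f * x ^ n‖) ∧ HasSum (fun n => coeff n f * x ^ n) v

namespace HasEval

variable {f g : PowerSeries ℝ} {x v w : ℝ}

theorem add (hf : HasEval f x v) (hg : HasEval g x w) : HasEval (f + g) x (v + w) := by
  have h : ∀ n, coeff n (f + g) * x ^ n = coeff n f * x ^ n + coeff n g * x ^ n := fun n => by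
    rw [map_add, add_mul]
  simp only [HasEval, h]
  exact ⟨(hf.1.add hg.1).of_nonneg_of_le (fun _ => norm_nonneg _) (fun _ => norm_add_le _ _),
    hf.2.add hg.2⟩

theorem neg (hf : HasEval f x v) : HasEval (-f) x (-v) := by
  have h : ∀ n, coeff n (-f) * x ^ n = -(coeff n f * x ^ n) := fun n => by
    rw [map_neg, neg_mul]
  simp only [HasEval, h, norm_neg]
  exact ⟨hf.1, hf.2.neg⟩

theorem sub (hf : HasEval f x v) (hg : HasEval g x w) : HasEval (f - g) x (v - w) := by
  rw [sub_eq_add_neg, sub_eq_add_neg]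
  exact hf.add hg.neg

theorem mul (hf : HasEval f x v) (hg : HasEval g x w) : HasEval (f * g) x (v * w) := by
  have h : ∀ n, coeff n (f * g) * x ^ n = ∑ p ∈ Finset.HasAntidiagonal.antidiagonal n,
      (coeff p.1 f * x ^ p.1) * (coeff p.2 g * x ^ p.2) := fun n => by
    rw [coeff_mul, Finset.sum_mul]
    refine Finset.sum_congr rfl fun p hp => ?_
    rw [← Finset.HasAntidiagonal.mem_antidiagonal.1 hp, pow_add]
    ring
  have hs := summable_norm_sum_mul_antidiagonal_of_summable_norm hf.1 hg.1
  simp only [HasEval, h]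
  refine ⟨hs, ?_⟩
  rw [← hf.2.tsum_eq, ← hg.2.tsum_eq,
    tsum_mul_tsum_eq_tsum_sum_antidiagonal_of_summable_norm hf.1 hg.1]
  exact hs.of_norm.hasSum

theorem one (x : ℝ) : HasEval 1 x 1 := by
  have h : ∀ n, n ≠ 0 → coeff n (1 : PowerSeries ℝ) * x ^ n = 0 := fun n hn => by
    rw [coeff_one, if_neg hn, zero_mul]
  constructor
  · refine summable_of_ne_finset_zero (s := {0}) fun n hn => ?_
    rw [h n (by simpa using hn), norm_zero]
  · have := hasSum_single (f := fun n => coeff n (1 : PowerSeries ℝ) * x ^ n) 0 h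
    simpa using this

theorem X (x : ℝ) : HasEval X x x := by
  have h : ∀ n, n ≠ 1 → coeff n (PowerSeries.X : PowerSeries ℝ) * x ^ n = 0 := fun n hn => by
    rw [coeff_X, if_neg hn, zero_mul]
  constructor
  · refine summable_of_ne_finset_zero (s := {1}) fun n hn => ?_
    rw [h n (by simpa using hn), norm_zero]
  · have := hasSum_single (f := fun n => coeff n (PowerSeries.X : PowerSeries ℝ) * x ^ n) 1 h
    simpa using this

theorem pow (hf : HasEval f x v) (k : ℕ) : HasEval (f ^ k) x (v ^ k) := by
  induction k with
  | zero => simpa using one x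
  | succ k ih => rw [pow_succ, pow_succ]; exact ih.mul hf

theorem unique (hf : HasEval f x v) (hf' : HasEval f x w) : v = w := hf.2.unique hf'.2

end HasEval

theorem hasEval_geomGF {x : ℝ} (h0 : 0 < x) (h1 : x < 1) : HasEval geomGF x (1 - x)⁻¹ := by
  have h : ∀ n, coeff n geomGF * x ^ n = x ^ n := fun n => by simp [geomGF]
  simp only [HasEval, h]
  have hx : ‖x‖ < 1 := by rwa [Real.norm_of_nonneg h0.le]
  exact ⟨summable_norm_geometric_of_norm_lt_one hx, hasSum_geometric_of_norm_lt_one hx⟩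

theorem hasEval_altGF {x : ℝ} (h0 : 0 < x) (h1 : x < 1) : HasEval altGF x (1 + x)⁻¹ := by
  have h : ∀ n, coeff n altGF * x ^ n = (-x) ^ n := fun n => by
    rw [altGF, coeff_mk, neg_pow x]
  simp only [HasEval, h]
  have hx : ‖-x‖ < 1 := by rwa [norm_neg, Real.norm_of_nonneg h0.le]
  refine ⟨summable_norm_geometric_of_norm_lt_one hx, ?_⟩
  have := hasSum_geometric_of_norm_lt_one hx
  rwa [sub_neg_eq_add] at this

/-- Coefficients are at most `2^n`, so the series converges absolutely below `1/2` and its quadratic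
equation passes to values. -/
theorem exists_hasEval_centralGF {x : ℝ} (h0 : 0 < x) (h1 : x < 1 / 2) :
    ∃ c, 0 ≤ c ∧ HasEval centralGF x c ∧ c * (1 - 2 * x) * (1 + x * c) = 1 := by
  have hs : Summable fun n => ‖coeff n centralGF * x ^ n‖ := by
    have hg : Summable fun n : ℕ => (2 * x) ^ n :=
      summable_geometric_of_lt_one (by linarith) (by linarith)
    refine hg.of_nonneg_of_le (fun _ => norm_nonneg _) fun n => ?_
    rw [centralGF, coeff_mk, Real.norm_of_nonneg (by positivity), mul_pow]
    gcongr
    exact_mod_cast Nat.choose_le_two_pow n (n / 2)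
  have hc : HasEval centralGF x (∑' n, coeff n centralGF * x ^ n) := ⟨hs, hs.of_norm.hasSum⟩
  refine ⟨_, tsum_nonneg fun n => ?_, hc, ?_⟩
  · rw [centralGF, coeff_mk]
    positivity
  · have h2 : HasEval (2 : PowerSeries ℝ) x 2 := by
      have := (HasEval.one x).add (HasEval.one x)
      rwa [one_add_one_eq_two, one_add_one_eq_two] at this
    have h3 := (hc.mul ((HasEval.one x).sub (h2.mul (HasEval.X x)))).mul
      ((HasEval.one x).add ((HasEval.X x).mul hc))
    rw [centralGF_quadratic] at h3
    exact h3.unique (HasEval.one x)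

/-! ### The positive root of `polyQ` -/

theorem eval_polyQ (x : ℝ) : polyQ.eval x =
    1 - 6 * x + 4 * x ^ 2 + 50 * x ^ 3 - 141 * x ^ 4 + 55 * x ^ 5 + 326 * x ^ 6 - 514 * x ^ 7
    - 26 * x ^ 8 + 725 * x ^ 9 - 561 * x ^ 10 - 223 * x ^ 11 + 540 * x ^ 12 - 206 * x ^ 13
    - 113 * x ^ 14 + 120 * x ^ 15 - 32 * x ^ 16 := by
  simp [polyQ]

theorem lt_half_of_eval_polyQ {x : ℝ} (h0 : 0 < x) (hx : polyQ.eval x = 0) : x < 1 / 2 := by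
  by_contra hc
  rw [eval_polyQ] at hx
  obtain ⟨D, hD⟩ : ∃ D, D = (1 - x) ^ 5 * (1 + x) ^ 2 := ⟨_, rfl⟩
  obtain ⟨M, hM⟩ : ∃ M, M = 2 * D + x ^ 2 * (1 - x) ^ 3 * (1 + x) ^ 2 - x ^ 7 := ⟨_, rfl⟩
  -- The left side is `4x q(x)`. For `x ≥ 1/2` neither contribution is positive, so `D = 0` and `x =
  -- 1`, where `q` does not vanish.
  have key : (1 - 2 * x) * (D + 2 * x * M) ^ 2 - (1 + 2 * x) * D ^ 2 = 0 := by
    rw [hM, hD]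
    linear_combination (4 * x) * hx
  have h1 : 0 ≤ (2 * x - 1) * (D + 2 * x * M) ^ 2 :=
    mul_nonneg (by linarith) (sq_nonneg _)
  have h2 : (1 + 2 * x) * D ^ 2 ≤ 0 := by linarith
  have h3 : D = 0 := by
    by_contra hD0
    have : 0 < (1 + 2 * x) * D ^ 2 := by positivity
    linarith
  have h4 : x = 1 := by
    rw [h3] at hD
    have h5 : (1 - x) ^ 5 = 0 := by
      have : (1 + x) ^ 2 ≠ 0 := by positivity
      exact (mul_eq_zero.1 hD.symm).resolve_right this
    have := pow_eq_zero_iff (by norm_num) |>.1 h5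
    linarith
  subst h4
  norm_num at hx

/-- At a root of `q`, both `M` and `D * c` are nonnegative solutions `t` of `(1-2x) t (D + x t) =
D²`, hence equal; this is the equation `I(x) = 1`. -/
theorem hasSum_indecInvol {x : ℝ} (h0 : 0 < x) (hx : polyQ.eval x = 0) :
    HasSum (fun n => ((indecInvol n).ncard : ℝ) * x ^ n) 1 := by
  have h1 := lt_half_of_eval_polyQ h0 hx
  rw [eval_polyQ] at hx
  obtain ⟨c, hc0, hc, hcq⟩ := exists_hasEval_centralGF h0 h1
  have hG := hasEval_geomGF h0 (by linarith)
  have hA := hasEval_altGF h0 (by linarith)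
  have hX := HasEval.X x
  have hH := ((hc.sub (HasEval.one x)).sub ((hX.pow 2).mul (hG.pow 2))).add
    (((hX.pow 7).mul (hG.pow 5)).mul (hA.pow 2))
  rw [← setGF_indecInvol] at hH
  have hv : c - 1 - x ^ 2 * (1 - x)⁻¹ ^ 2 + x ^ 7 * (1 - x)⁻¹ ^ 5 * (1 + x)⁻¹ ^ 2 = 1 := by
    obtain ⟨D, hD⟩ : ∃ D, D = (1 - x) ^ 5 * (1 + x) ^ 2 := ⟨_, rfl⟩
    obtain ⟨M, hM⟩ : ∃ M, M = 2 * D + x ^ 2 * (1 - x) ^ 3 * (1 + x) ^ 2 - x ^ 7 := ⟨_, rfl⟩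
    have hx1 : 0 < 1 - x := by linarith
    have hDpos : 0 < D := by rw [hD]; positivity
    have hDx : x ^ 7 ≤ D := by
      rw [hD]
      have e1 : x ^ 5 ≤ (1 - x) ^ 5 := by gcongr; linarith
      have e2 : x ^ 2 ≤ (1 + x) ^ 2 := by gcongr; linarith
      calc x ^ 7 = x ^ 5 * x ^ 2 := by ring
        _ ≤ _ := by gcongr
    have hMpos : 0 < M := by
      have : 0 < x ^ 2 * (1 - x) ^ 3 * (1 + x) ^ 2 := by positivity
      linarith
    have e1 : (1 - 2 * x) * (M * (D + x * M)) = D ^ 2 := by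
      rw [hM, hD]
      linear_combination hx
    have e2 : (1 - 2 * x) * ((D * c) * (D + x * (D * c))) = D ^ 2 := by
      linear_combination D ^ 2 * hcq
    have e3 : (1 - 2 * x) * ((M - D * c) * (D + x * (M + D * c))) = 0 := by
      linear_combination e1 - e2
    have e4 : M = D * c := by
      have p1 : 0 < D + x * (M + D * c) := by positivity
      have p2 : 1 - 2 * x ≠ 0 := by linarith
      have := ((mul_eq_zero.1 ((mul_eq_zero.1 e3).resolve_left p2)).resolve_right p1.ne')
      linarith
    have hx1' := hx1.ne'
    have hx2 : 1 + x ≠ 0 := by positivity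
    rw [hM, hD] at e4
    field_simp
    linear_combination -e4
  rw [hv] at hH
  simpa only [setGF, coeff_mk] using hH.2

theorem ncard_indecInvol_zero : (indecInvol 0).ncard = 0 := by
  have h : indecInvol 0 = ∅ := Set.eq_empty_iff_forall_notMem.2 fun f h => absurd h.1 (by omega)
  rw [h, Set.ncard_empty]

/-- As `I` has no constant term, `I(t)/t` has nonnegative coefficients and is monotone. Summed over
`n`, this gives `y I(x) ≤ x I(y)`, so `I(x) = I(y) = 1` excludes `x < y`. -/
theorem indecInvol_term_le {x y : ℝ} (hx : 0 < x) (hxy : x ≤ y) (n : ℕ) :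
    y * (((indecInvol n).ncard : ℝ) * x ^ n) ≤ x * (((indecInvol n).ncard : ℝ) * y ^ n) := by
  cases n with
  | zero => simp [ncard_indecInvol_zero]
  | succ n =>
    calc y * (((indecInvol (n + 1)).ncard : ℝ) * x ^ (n + 1))
        = x * y * ((indecInvol (n + 1)).ncard : ℝ) * x ^ n := by ring
      _ ≤ x * y * ((indecInvol (n + 1)).ncard : ℝ) * y ^ n := by
          have : 0 < y := hx.trans_le hxy
          gcongr
      _ = _ := by ring

theorem polyQ_root_unique {x y : ℝ} (hx : 0 < x) (hy : 0 < y) (hqx : polyQ.eval x = 0)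
    (hqy : polyQ.eval y = 0) : x = y := by
  have key : ∀ {x y : ℝ}, 0 < x → 0 < y → polyQ.eval x = 0 → polyQ.eval y = 0 → ¬ x < y := by
    intro x y hx hy hqx hqy hxy
    have := hasSum_le (indecInvol_term_le hx hxy.le) ((hasSum_indecInvol hx hqx).mul_left y)
      ((hasSum_indecInvol hy hqy).mul_left x)
    linarith
  exact le_antisymm (not_lt.1 (key hy hx hqy hqx)) (not_lt.1 (key hx hy hqx hqy))

theorem exists_polyQ_root :
    ∃ ρ : ℝ, 0 < ρ ∧ polyQ.eval ρ = 0 ∧ |ρ⁻¹ - 2.54| < 0.005 := by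
  -- The endpoints are the reciprocals of `2.545` and `2.535`.
  have ha : (0 : ℝ) < polyQ.eval (200 / 509) := by rw [eval_polyQ]; norm_num
  have hb : polyQ.eval (200 / 507 : ℝ) < 0 := by rw [eval_polyQ]; norm_num
  obtain ⟨ρ, ⟨h1, h2⟩, h3⟩ := intermediate_value_Icc' (f := fun x : ℝ => polyQ.eval x)
    (show (200 / 509 : ℝ) ≤ 200 / 507 by norm_num) polyQ.continuous.continuousOn
    (show (0 : ℝ) ∈ Set.Icc _ _ from ⟨hb.le, ha.le⟩)
  have h4 : (200 / 509 : ℝ) < ρ := lt_of_le_of_ne h1 fun e => by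
    rw [e] at ha
    exact ha.ne' h3
  have h5 : ρ < 200 / 507 := lt_of_le_of_ne h2 fun e => by
    rw [← e] at hb
    exact hb.ne h3
  have h0 : 0 < ρ := lt_trans (by norm_num) h4
  refine ⟨ρ, h0, h3, ?_⟩
  have h6 : ρ⁻¹ < 509 / 200 := by
    rw [inv_lt_comm₀ h0 (by norm_num)]
    norm_num
    exact h4
  have h7 : 507 / 200 < ρ⁻¹ := by
    rw [lt_inv_comm₀ (by norm_num) h0]
    norm_num
    exact h5
  rw [abs_lt]
  constructor <;> norm_num <;> linarith

/-! ### The growth rate -/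

theorem ncard_avInvol_recurrence {n : ℕ} (hn : 0 < n) (x : ℝ) :
    ((avInvol n).ncard : ℝ) * x ^ n = ∑ i ∈ Finset.range (n + 1),
      (((indecInvol i).ncard : ℝ) * x ^ i) * (((avInvol (n - i)).ncard : ℝ) * x ^ (n - i)) := by
  have h := congrArg (coeff n) setGF_avInvol
  rw [map_add, coeff_one, if_neg (by omega), zero_add, coeff_mul] at h
  simp only [setGF, coeff_mk] at h
  rw [h, Finset.Nat.sum_antidiagonal_eq_sum_range_succ
    (fun i j => ((indecInvol i).ncard : ℝ) * ((avInvol j).ncard : ℝ)), Finset.sum_mul]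
  refine Finset.sum_congr rfl fun i hi => ?_
  rw [Finset.mem_range] at hi
  have : x ^ n = x ^ i * x ^ (n - i) := by rw [← pow_add]; congr 1; omega
  rw [this]
  ring

/-- The recurrence bounds `a_n ρ^n` by earlier values weighted by the terms of `I(ρ)`, which sum to
`1`. -/
theorem ncard_avInvol_mul_pow_le {ρ : ℝ} (h0 : 0 < ρ) (hρ : polyQ.eval ρ = 0) (n : ℕ) :
    ((avInvol n).ncard : ℝ) * ρ ^ n ≤ 1 := by
  induction n using Nat.strong_induction_on with
  | _ n ih =>
    rcases Nat.eq_zero_or_pos n with rfl | hn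
    · simp [ncard_avInvol_zero]
    · rw [ncard_avInvol_recurrence hn]
      calc _ ≤ ∑ i ∈ Finset.range (n + 1), ((indecInvol i).ncard : ℝ) * ρ ^ i := by
            refine Finset.sum_le_sum fun i _ => ?_
            rcases Nat.eq_zero_or_pos i with rfl | hi
            · simp [ncard_indecInvol_zero]
            · exact mul_le_of_le_one_right (by positivity) (ih (n - i) (by omega))
        _ ≤ 1 := sum_le_hasSum _ (fun i _ => by positivity) (hasSum_indecInvol h0 hρ)

theorem one_le_ncard_avInvol (n : ℕ) : 1 ≤ (avInvol n).ncard := by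
  have h := revPerm_mem_decPrefix n
  exact (Set.ncard_pos (finite_avInvol n)).2 ⟨revPerm n, h.1, avoids2341_of_avoids123 h.1 h.2.1⟩

theorem exists_le_ncard_avInvol_mul_pow {ρ r : ℝ} (h0 : 0 < ρ) (hρ : polyQ.eval ρ = 0)
    (hr : ρ < r) (hr1 : r ≤ 1) : ∃ K : ℕ, ∀ n, r ^ K ≤ ((avInvol n).ncard : ℝ) * r ^ n := by
  have hr0 : 0 < r := h0.trans hr
  have hlim := (hasSum_indecInvol h0 hρ).tendsto_sum_nat
  -- A partial sum of `I(ρ)` above `ρ / r` forces the same partial sum at `r` to be at least `1`.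
  -- From `K` on the recurrence then preserves the bound `r ^ K`; below `K` it follows from `a_n ≥
  -- 1`.
  obtain ⟨K, hK⟩ := (hlim.eventually (lt_mem_nhds (show ρ / r < 1 by rwa [div_lt_one hr0]))).exists
  have hK1 : 1 ≤ ∑ i ∈ Finset.range K, ((indecInvol i).ncard : ℝ) * r ^ i := by
    have h1 : r * ∑ i ∈ Finset.range K, ((indecInvol i).ncard : ℝ) * ρ ^ i ≤
        ρ * ∑ i ∈ Finset.range K, ((indecInvol i).ncard : ℝ) * r ^ i := by
      rw [Finset.mul_sum, Finset.mul_sum]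
      exact Finset.sum_le_sum fun i _ => indecInvol_term_le h0 hr.le i
    rw [div_lt_iff₀ hr0] at hK
    by_contra hc
    have := mul_lt_mul_of_pos_left (not_le.1 hc) h0
    linarith
  refine ⟨K, fun n => ?_⟩
  induction n using Nat.strong_induction_on with
  | _ n ih =>
    rcases Nat.lt_or_ge n K with h | h
    · have h1 : (1 : ℝ) ≤ ((avInvol n).ncard : ℝ) := by exact_mod_cast one_le_ncard_avInvol n
      calc r ^ K ≤ r ^ n := pow_le_pow_of_le_one hr0.le hr1 h.le
        _ ≤ _ := le_mul_of_one_le_left (by positivity) h1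
    · have hn : 0 < n := by
        rcases Nat.eq_zero_or_pos n with rfl | hn
        · obtain rfl : K = 0 := by omega
          norm_num at hK1
        · exact hn
      rw [ncard_avInvol_recurrence hn]
      calc r ^ K ≤ (∑ i ∈ Finset.range K, ((indecInvol i).ncard : ℝ) * r ^ i) * r ^ K :=
            le_mul_of_one_le_left (by positivity) hK1
        _ = ∑ i ∈ Finset.range K, (((indecInvol i).ncard : ℝ) * r ^ i) * r ^ K :=
            Finset.sum_mul _ _ _
        _ ≤ ∑ i ∈ Finset.range K, (((indecInvol i).ncard : ℝ) * r ^ i) *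
              (((avInvol (n - i)).ncard : ℝ) * r ^ (n - i)) := by
            refine Finset.sum_le_sum fun i _ => ?_
            rcases Nat.eq_zero_or_pos i with rfl | hi
            · simp [ncard_indecInvol_zero]
            · exact mul_le_mul_of_nonneg_left (ih (n - i) (by omega)) (by positivity)
        _ ≤ _ := by
            refine Finset.sum_le_sum_of_subset_of_nonneg ?_ fun i _ _ => by positivity
            exact Finset.range_subset_range.2 (by omega)

theorem tendsto_ncard_avInvol {ρ : ℝ} (h0 : 0 < ρ) (hρ : polyQ.eval ρ = 0) :
    Tendsto (fun n : ℕ => ((avInvol n).ncard : ℝ) ^ (1 / (n : ℝ))) atTop (𝓝 ρ⁻¹) := by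
  have root_pow : ∀ {y : ℝ} {n : ℕ}, 0 ≤ y → 0 < n → (y ^ n) ^ (1 / (n : ℝ)) = y := by
    intro y n hy hn
    rw [one_div, Real.pow_rpow_inv_natCast hy (by omega)]
  rw [tendsto_order]
  constructor
  · intro l hl
    have hρ1 : ρ < 1 := by linarith [lt_half_of_eval_polyQ h0 hρ]
    -- The lower bound is only available for `r > ρ`, so `r` is taken close enough to `ρ` that `r⁻¹`
    -- still exceeds `l`.
    obtain ⟨r, ⟨hlr, hr1⟩, hr⟩ : ∃ r, (l < r⁻¹ ∧ r < 1) ∧ ρ < r := by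
      have e1 : ∀ᶠ r in 𝓝[>] ρ, l < r⁻¹ :=
        ((tendsto_inv₀ h0.ne').eventually (lt_mem_nhds hl)).filter_mono nhdsWithin_le_nhds
      have e2 : ∀ᶠ r in 𝓝[>] ρ, r < 1 := (gt_mem_nhds hρ1).filter_mono nhdsWithin_le_nhds
      exact ((e1.and e2).and self_mem_nhdsWithin).exists
    have hr0 : 0 < r := h0.trans hr
    obtain ⟨K, hK⟩ := exists_le_ncard_avInvol_mul_pow h0 hρ hr hr1.le
    have hlim : Tendsto (fun n : ℕ => (r ^ K) ^ (1 / (n : ℝ)) * r⁻¹) atTop (𝓝 r⁻¹) := by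
      have h1 : Tendsto (fun n : ℕ => (r ^ K) ^ (1 / (n : ℝ))) atTop (𝓝 ((r ^ K) ^ (0 : ℝ))) :=
        ((Real.continuous_const_rpow (pow_ne_zero K hr0.ne')).tendsto 0).comp
          tendsto_one_div_atTop_nhds_zero_nat
      rw [Real.rpow_zero] at h1
      simpa using h1.mul_const r⁻¹
    filter_upwards [hlim.eventually (lt_mem_nhds hlr), eventually_gt_atTop 0] with n h1 hn
    refine h1.trans_le ?_
    have h2 : r ^ K * r⁻¹ ^ n ≤ ((avInvol n).ncard : ℝ) := by
      rw [inv_pow, ← div_eq_mul_inv, div_le_iff₀ (by positivity)]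
      exact hK n
    calc (r ^ K) ^ (1 / (n : ℝ)) * r⁻¹
        = (r ^ K * r⁻¹ ^ n) ^ (1 / (n : ℝ)) := by
          rw [Real.mul_rpow (by positivity) (by positivity), root_pow (by positivity) hn]
      _ ≤ _ := Real.rpow_le_rpow (by positivity) h2 (by positivity)
  · intro u hu
    filter_upwards [eventually_gt_atTop 0] with n hn
    refine lt_of_le_of_lt ?_ hu
    have h2 : ((avInvol n).ncard : ℝ) ≤ ρ⁻¹ ^ n := by
      rw [inv_pow, ← one_div, le_div_iff₀ (by positivity)]
      exact ncard_avInvol_mul_pow_le h0 hρ n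
    calc _ ≤ (ρ⁻¹ ^ n) ^ (1 / (n : ℝ)) := Real.rpow_le_rpow (by positivity) h2 (by positivity)
      _ = ρ⁻¹ := root_pow (by positivity) hn

theorem hasGrowthRate {ρ : ℝ} (h0 : 0 < ρ) (hρ : polyQ.eval ρ = 0) :
    HasGrowthRate {⟨4, perm2341⟩} ρ⁻¹ := by
  have h := (continuous_coe_real_ereal.tendsto ρ⁻¹).comp (tendsto_ncard_avInvol h0 hρ)
  simp only [HasGrowthRate, upperGrowthRate, lowerGrowthRate, ncard_avI]
  exact ⟨h.limsup_eq, h.liminf_eq⟩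

theorem natDegree_polyP : polyP.natDegree = 16 := by
  unfold polyP
  compute_degree!

theorem natDegree_polyQ : polyQ.natDegree = 16 := by
  unfold polyQ
  compute_degree!

end PermPattern

theorem mainTheorem2 :
    (∀ n : ℕ, PermPattern.avI {⟨4, PermPattern.perm2341⟩} n =
      PermPattern.avI {⟨4, PermPattern.perm2341⟩, ⟨4, PermPattern.perm4123⟩} n) ∧
    PermPattern.polyP.natDegree = 16 ∧ PermPattern.polyQ.natDegree = 16 ∧
    (∃ s : PowerSeries ℝ, PermPattern.IsSqrtSeries s ∧
      PermPattern.genFun {⟨4, PermPattern.perm2341⟩} =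
        ((PowerSeries.X + 1) ^ 4 * (PowerSeries.X - 1) ^ 10 * s
            - (PermPattern.polyP : PowerSeries ℝ))
          * (2 * (PermPattern.polyQ : PowerSeries ℝ))⁻¹) ∧
    (∃ ρ : ℝ, (0 < ρ ∧ PermPattern.polyQ.eval ρ = 0) ∧
      (∀ x : ℝ, 0 < x → PermPattern.polyQ.eval x = 0 → x = ρ) ∧
      PermPattern.HasGrowthRate {⟨4, PermPattern.perm2341⟩} ρ⁻¹ ∧
      |ρ⁻¹ - 2.54| < 0.005) := by
  refine ⟨PermPattern.avI_perm2341_eq, PermPattern.natDegree_polyP, PermPattern.natDegree_polyQ,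
    ⟨_, PermPattern.isSqrtSeries_sqrtGF, PermPattern.genFun_eq⟩, ?_⟩
  obtain ⟨ρ, h0, hρ, hb⟩ := PermPattern.exists_polyQ_root
  exact ⟨ρ, ⟨h0, hρ⟩, fun x hx hq => PermPattern.polyQ_root_unique hx h0 hq hρ,
    PermPattern.hasGrowthRate h0 hρ, hb⟩
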